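/- Let $n\ge 2$ be a natural number, let $(q,p)=(q^1,\dots,q^n,p_1,\dots,p_n)$ be real coordinates on phase space with the canonical Poisson bracket, $\{q^i,p_j\}=\delta^i_j$, i.e. $\{f,g\}=\sum_{j=1}^n\bigl(\frac{\partial f}{\partial q^j}\frac{\partial g}{\partial p_j}-\frac{\partial f}{\partial p_j}\frac{\partial g}{\partial q^j}\bigr)$, and put $q^0=1$ and $q^j=0$ for $j>n$. Let $G$ be the $n\times n$ matrix with entries $G^{lm}=q^{l+m-n-1}$ if $l+m\ge n+1$ and $G^{lm}=0$ otherwise, and let $L$ be the $n\times n$ matrix with first column $(-q^1,\dots,-q^n)^T$, ones on the superdiagonal and zeros elsewhere. For $i\ge 0$ and $r=1,\dots,n$ set $$K_r=\sum_{j=0}^{r-1}q^jL^{r-1-j},\qquad E_{i,r}=\tfrac12\sum_{l,m=1}^n (K_rL^iG)^{lm}p_lp_m .$$ The basic separable potentials $V_r^{(k)}$, $k\in\mathbb Z$, $1\le r\le n$, are defined by $V_r^{(0)}=0$, $V_r^{(1)}=-q^r$, $V_r^{(-1)}=-q^{r-1}/q^n$ and, for $m\ge1$, $$V_r^{(m+1)}=V_{r+1}^{(m)}+V_r^{(1)}V_1^{(m)},\qquad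 V_r^{(-m-1)}=V_{r-1}^{(-m)}+V_r^{(-1)}V_n^{(-m)},$$ where $V_{n+1}^{(m)}=0$ and $V_0^{(-m)}=0$. Put $H_{i,r}^{(k)}=E_{i,r}+V_r^{(k)}$. These functions are considered on $U=\mathbb R^{2n}$ if $k\ge0$ and on $U=\{(q,p)\in\mathbb R^{2n}: q^n\ne0\}$ if $k<0$. An integral of motion of a Hamiltonian $H$ on $U$ is a real analytic function $f$ on $U$ with $\{H,f\}=0$. Functions on $U$ are called functionally independent if their differentials are linearly independent at every point of an open dense subset of $U$. The Hamiltonian $H$ is called maximally superintegrable on $U$ if it has $2n-1$ functionally independent integrals of motion on $U$, of which $n$, including $H$ itself, are pairwise in involution. **Theorem 1.** Suppose that either (a) $0\le i\le n-1$ and $-i\le k\le n-1-i$, and $F_{i,s}^{(k)}=\{H_{i,s}^{(k)},p_{n-i}\}$ for $s=2,\dots,n$; or (b) $i\in\{n,n+1\}$ and $2-i\le k\le n+1-i$, and $F_{i,s}^{(k)}=\{H_{i,s}^{(k)},q^np_{n-i+2}\}$ for $s=2,\dots,n$. Then $H_{i,1}^{(k)}$ is maximally superintegrable on $U$. Namely,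 $H_{i,r}^{(k)}$, $r=1,\dots,n$, are integrals of motion of $H_{i,1}^{(k)}$ that are pairwise in involution; $F_{i,s}^{(k)}$, $s=2,\dots,n$, are $n-1$ further integrals of motion of $H_{i,1}^{(k)}$, each of them quadratic in the momenta, that is, of the form $\sum_{l,m}A^{lm}(q)p_lp_m+C(q)$ with real analytic coefficients and $A$ symmetric and not identically zero; and the $2n-1$ functions $H_{i,1}^{(k)},\dots,H_{i,n}^{(k)},F_{i,2}^{(k)},\dots,F_{i,n}^{(k)}$ are functionally independent on $U$. -/

import Mathlib

noncomputable section

namespace Benenti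

/-- The chart `(q, p)` of the cotangent bundle of an `n`-dimensional manifold:
`q = (q¹, …, qⁿ)` is the first component and `p = (p₁, …, pₙ)` the second one. -/
abbrev PhaseSpace (n : ℕ) : Type := (Fin n → ℝ) × (Fin n → ℝ)

/-- The coordinate `q^j` with `1`-based index, with the conventions `q⁰ = 1` and
`q^j = 0` for `j > n`. -/
def qc {n : ℕ} (q : Fin n → ℝ) (j : ℕ) : ℝ :=
  if j = 0 then 1 else if h : j - 1 < n then q ⟨j - 1, h⟩ else 0

/-- The momentum `p_j` with `1`-based index, `1 ≤ j ≤ n` (and `0` for other `j`). -/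
def pc {n : ℕ} (p : Fin n → ℝ) (j : ℕ) : ℝ :=
  if j = 0 then 0 else if h : j - 1 < n then p ⟨j - 1, h⟩ else 0

/-- The matrix `G`. With `1`-based indices its entry `(l, m)` is `q^(l+m-n-1)` if
`l + m ≥ n + 1`, and `0` otherwise. -/
def metricG (n : ℕ) (q : Fin n → ℝ) : Matrix (Fin n) (Fin n) ℝ :=
  Matrix.of fun a b =>
    if n ≤ (a : ℕ) + b + 1 then qc q ((a : ℕ) + b + 1 - n) else 0

/-- The matrix `L`: first column `-q¹, …, -qⁿ`, ones on the superdiagonal, and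
zeros elsewhere (for `n ≥ 1`). -/
def tensorL (n : ℕ) (q : Fin n → ℝ) : Matrix (Fin n) (Fin n) ℝ :=
  Matrix.of fun a b =>
    if (b : ℕ) = 0 then -q a else if (b : ℕ) = a + 1 then 1 else 0

/-- The Killing tensor `K_r = ∑_{k=0}^{r-1} q^k L^(r-1-k)`, `1 ≤ r ≤ n`; so `K_1 = 1`. -/
def killingK (n r : ℕ) (q : Fin n → ℝ) : Matrix (Fin n) (Fin n) ℝ :=
  ∑ k ∈ Finset.range r, qc q k • tensorL n q ^ (r - 1 - k)

/-- `E_{i,r} = ½ ∑_{l,m} (K_r L^i G)^{lm} p_l p_m`. -/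
def geodesicE (n i r : ℕ) (z : PhaseSpace n) : ℝ :=
  (1 / 2 : ℝ) * ∑ l : Fin n, ∑ m : Fin n,
    (killingK n r z.1 * tensorL n z.1 ^ i * metricG n z.1) l m * z.2 l * z.2 m

/-- `posPotential n q m r` is the basic separable potential `V_r^{(m+1)}`. It is `0` for
`r` outside `1, …, n`. -/
def posPotential (n : ℕ) (q : Fin n → ℝ) : ℕ → ℕ → ℝ
  | 0, r => if 1 ≤ r ∧ r ≤ n then -qc q r else 0
  | m + 1, r =>
      if 1 ≤ r ∧ r ≤ n then
        posPotential n q m (r + 1) + (-qc q r) * posPotential n q m 1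
      else 0

/-- `negPotential n q m r` is the basic separable potential `V_r^{(-m-1)}`. It is `0` for
`r` outside `1, …, n`. -/
def negPotential (n : ℕ) (q : Fin n → ℝ) : ℕ → ℕ → ℝ
  | 0, r => if 1 ≤ r ∧ r ≤ n then -(qc q (r - 1) / qc q n) else 0
  | m + 1, r =>
      if 1 ≤ r ∧ r ≤ n then
        negPotential n q m (r - 1) + (-(qc q (r - 1) / qc q n)) * negPotential n q m n
      else 0

/-- The basic separable potential `V_r^{(k)}`, `k ∈ ℤ`. -/
def potentialV (n : ℕ) (q : Fin n → ℝ) : ℤ → ℕ → ℝ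
  | Int.ofNat 0, _ => 0
  | Int.ofNat (m + 1), r => posPotential n q m r
  | Int.negSucc m, r => negPotential n q m r

/-- `H_{i,r}^{(k)} = E_{i,r} + V_r^{(k)}`. -/
def hamiltonianH (n i r : ℕ) (k : ℤ) (z : PhaseSpace n) : ℝ :=
  geodesicE n i r z + potentialV n z.1 k r

/-- The set of all `q` at which the functions `V_r^{(k)}` are defined: everything for
`k ≥ 0`, and `{qⁿ ≠ 0}` for `k < 0`. -/
def chart (n : ℕ) (k : ℤ) : Set (Fin n → ℝ) := {q | k < 0 → qc q n ≠ 0}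

/-- The part of the phase space over a set `D` of positions. -/
def cotangent {n : ℕ} (D : Set (Fin n → ℝ)) : Set (PhaseSpace n) := {z | z.1 ∈ D}

/-- The canonical Poisson bracket, normalised by `{q^i, p_j} = δ^i_j`. -/
def poissonBracket {n : ℕ} (f g : PhaseSpace n → ℝ) (z : PhaseSpace n) : ℝ :=
  ∑ j : Fin n,
    (fderiv ℝ f z (Pi.single j 1, 0) * fderiv ℝ g z (0, Pi.single j 1)
      - fderiv ℝ f z (0, Pi.single j 1) * fderiv ℝ g z (Pi.single j 1, 0))

/-- `f` is a (real analytic) integral of motion on `U` of the system with Hamiltonian `H`. -/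
def IsIntegralOfMotion {n : ℕ} (U : Set (PhaseSpace n)) (H f : PhaseSpace n → ℝ) : Prop :=
  AnalyticOnNhd ℝ f U ∧ ∀ z ∈ U, poissonBracket H f z = 0

/-- Functional independence on `U`: the differentials of the given functions are linearly
independent at every point of an open dense subset of `U`. -/
def FunctionallyIndependent {n : ℕ} {ι : Type} (U : Set (PhaseSpace n))
    (f : ι → PhaseSpace n → ℝ) : Prop :=
  ∃ W : Set (PhaseSpace n), IsOpen W ∧ W ⊆ U ∧ U ⊆ closure W ∧
    ∀ z ∈ W, LinearIndependent ℝ fun a => fderiv ℝ (f a) z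

/-- `f` is quadratic in the momenta over `D`:
`f = ∑ A^{lm}(q) p_l p_m + C(q)` with analytic coefficients, `A` symmetric and not
identically zero. -/
def IsQuadraticInMomenta {n : ℕ} (D : Set (Fin n → ℝ)) (f : PhaseSpace n → ℝ) : Prop :=
  ∃ (A : (Fin n → ℝ) → Matrix (Fin n) (Fin n) ℝ) (C : (Fin n → ℝ) → ℝ),
    (∀ l m, AnalyticOnNhd ℝ (fun q => A q l m) D) ∧ AnalyticOnNhd ℝ C D ∧
    (∀ q ∈ D, (A q).IsSymm) ∧ (∃ q ∈ D, A q ≠ 0) ∧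
    ∀ z ∈ cotangent D, f z = ∑ l : Fin n, ∑ m : Fin n, A z.1 l m * z.2 l * z.2 m + C z.1

/-- Maximal superintegrability on `U` (`n` degrees of freedom): there are `2n - 1`
functionally independent integrals of motion of `H`, of which `n`, including `H` itself, are
pairwise in involution. -/
def IsMaximallySuperintegrable {n : ℕ} (U : Set (PhaseSpace n)) (H : PhaseSpace n → ℝ) :
    Prop :=
  ∃ (h : Fin n → PhaseSpace n → ℝ) (g : Fin (n - 1) → PhaseSpace n → ℝ),
    (∃ a, h a = H) ∧
    (∀ a, IsIntegralOfMotion U H (h a)) ∧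
    (∀ a b, ∀ z ∈ U, poissonBracket (h a) (h b) z = 0) ∧
    (∀ b, IsIntegralOfMotion U H (g b)) ∧
    FunctionallyIndependent U (Sum.elim h g)

end Benenti

end

/-!
The proof works with polynomials in one variable `x` instead of separation coordinates. Let
`U = x ^ n + q¹ x ^ (n - 1) + ⋯ + qⁿ` (`charPoly`), let `h_j` be its Horner truncations
(`h_0 = 1`, `h_{j+1} = x h_j + q^{j+1}`), and put `W = -∑ p_a h_{a-1}` (`momentumPoly`). Where `U` has
`n` distinct real roots, these roots are the separation coordinates, and the value of `W` at a
root is the conjugate momentum; all formulas below make sense without this assumption.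

*Separation relation.* The matrix `L` is multiplication by `x` modulo `U`, `K_r = h_{r-1}(L)`, and
the `m`-th column of `G` represents `h_{m-1}`. So, with `H = ∑ H_r x ^ (n - r)`,
`x ^ e H ≡ ½ x ^ (e + i) W² + Ψ (mod U)` for a polynomial `Ψ` not depending on `(q, p)`, as soon as `e ≥ -k`
(`separationRelation_hamiltonianH`). Differentiating this congruence and evaluating it at two
independent roots of `U`, in an iterated `AdjoinRoot`, gives `{H_r, H_s} = 0`
(`poissonBracket_eq_zero_of_separationRelation`).

*Quadratic integrals.* In case (a) put `e = f = i`, `κ = 1`, in case (b) `e = i - 2`,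
`f = i - 1`, `κ = qⁿ`. Then `{U, J} = κ x ^ e`, and if `S` is the remainder of `x ^ f W` modulo `U` and
`F = ∑ F_r x ^ (n - r)` with `F_r = {H_r, J}`, one has
`κ (½ S² + Ψ) = κ x ^ e H - U F` (`MomentumSymmetry.identity`). Indeed the difference of the two sides is
divisible by `U²`, while the bounds on `k` make its degree smaller than `2 n`. Comparing
the coefficients of `x ^ (2 n - 1)` gives `{H_1, J} = 0`, so that the `F_s` are integrals by the Jacobi
identity.

*Independence.* Along a tangent vector `v` annihilated by all `dH_r` and `dF_s` and not moving
`qⁿ` the identity yields `κ S S' = -F U'`. If `S` is coprime to `F`, has degree `n - 1` and does not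
vanish at `0`, then `U' = 0`, hence `S' = 0` and `v = 0`. Such a point exists on both sides of
`qⁿ = 0`: take `U = (x - 1) ^ (n - 1) (x - r)` and `S = s (x - 1) ^ (n - 1)`, where `s = 1` or `s = 2`
(`eval_one_ne_of_test`). By analyticity independence at one point of each half space
spreads to a dense open set. For `k = 0` it also shows that the quadratic part of `F_s`,
which does not depend on `k`, is not identically zero.
-/

noncomputable section

namespace Benenti

open Polynomial Filter Topology

variable {n : ℕ}

/-! ### Horner truncations and the characteristic polynomial -/

/-- The Horner truncation `h_j = ∑_{b ≤ j} q^b x ^ (j - b)` of the characteristic polynomial, with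
the `1`-based convention `q⁰ = 1` of `qc`. -/
def horner (q : Fin n → ℝ) : ℕ → ℝ[X]
  | 0 => 1
  | j + 1 => X * horner q j + C (qc q (j + 1))

/-- The derivative of `horner q j` with respect to `q` in the direction `u`. It does not depend
on `q`, since `horner q j` is affine in `q`. -/
def hornerDeriv (u : Fin n → ℝ) : ℕ → ℝ[X]
  | 0 => 0
  | j + 1 => X * hornerDeriv u j + C (qc u (j + 1))

/-- The polynomial `U = xⁿ + q¹ xⁿ⁻¹ + ⋯ + qⁿ`, the characteristic polynomial of `L`. -/
def charPoly (q : Fin n → ℝ) : ℝ[X] := horner q n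

/-- The polynomial of degree `< n` with coefficient vector `v`, the leading coefficient first.
Multiplication by `x` modulo `charPoly q` then corresponds to the matrix `tensorL n q`. -/
def vecPoly (v : Fin n → ℝ) : ℝ[X] := ∑ a : Fin n, C (v a) * X ^ (n - 1 - (a : ℕ))

/-- The polynomial `W` of degree `< n`, linear in the momenta, whose value at a root of
`charPoly` is the momentum conjugate to that root. -/
def momentumPoly (z : PhaseSpace n) : ℝ[X] := -∑ a : Fin n, C (z.2 a) * horner z.1 a

theorem qc_succ (q : Fin n → ℝ) (a : Fin n) : qc q ((a : ℕ) + 1) = q a := by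
  simp [qc]

theorem horner_monic_natDegree (q : Fin n → ℝ) (j : ℕ) :
    (horner q j).Monic ∧ (horner q j).natDegree = j := by
  induction j with
  | zero => simp [horner]
  | succ j ih =>
    have h1 : (X * horner q j).Monic := monic_X.mul ih.1
    have h2 : (X * horner q j).natDegree = j + 1 := by
      rw [natDegree_X_mul ih.1.ne_zero, ih.2]
    have h3 : (C (qc q (j + 1))).degree < (X * horner q j).degree := by
      rw [degree_eq_natDegree h1.ne_zero, h2]
      exact lt_of_le_of_lt degree_C_le (by exact_mod_cast Nat.succ_pos j)
    refine ⟨h1.add_of_left h3, ?_⟩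
    rw [horner, natDegree_add_eq_left_of_degree_lt h3, h2]

theorem horner_monic (q : Fin n → ℝ) (j : ℕ) : (horner q j).Monic :=
  (horner_monic_natDegree q j).1

theorem horner_degree (q : Fin n → ℝ) (j : ℕ) : (horner q j).degree = j := by
  rw [degree_eq_natDegree (horner_monic q j).ne_zero, (horner_monic_natDegree q j).2]

theorem charPoly_monic (q : Fin n → ℝ) : (charPoly q).Monic := horner_monic q n

theorem charPoly_degree (q : Fin n → ℝ) : (charPoly q).degree = n := horner_degree q n

theorem charPoly_natDegree (q : Fin n → ℝ) : (charPoly q).natDegree = n :=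
  (horner_monic_natDegree q n).2

theorem charPoly_eval_zero (q : Fin n → ℝ) : (charPoly q).eval 0 = qc q n := by
  cases n with
  | zero => simp [charPoly, horner, qc]
  | succ m => simp [charPoly, horner]

/-- Only the terms of degree `< m` are lost when `horner q (j + m)` is replaced by
`X ^ m * horner q j`. -/
theorem horner_add (q : Fin n → ℝ) (j m : ℕ) :
    ∃ R : ℝ[X], R.degree < m ∧ horner q (j + m) = X ^ m * horner q j + R := by
  induction m with
  | zero => exact ⟨0, by simp, by simp⟩
  | succ m ih =>
    obtain ⟨R, hR, h⟩ := ih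
    refine ⟨X * R + C (qc q (j + m + 1)), ?_, ?_⟩
    · rw [degree_lt_iff_coeff_zero] at hR ⊢
      intro k hk
      obtain ⟨k, rfl⟩ : ∃ k', k = k' + 1 := ⟨k - 1, by omega⟩
      simp [coeff_X_mul, hR k (by omega)]
    · rw [← add_assoc, horner, h]; ring

theorem hornerDeriv_single (b : Fin n) (j : ℕ) :
    hornerDeriv (Pi.single b 1) j = if (b : ℕ) < j then X ^ (j - 1 - (b : ℕ)) else 0 := by
  induction j with
  | zero => simp [hornerDeriv]
  | succ j ih =>
    rw [hornerDeriv, ih]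
    rcases lt_trichotomy (b : ℕ) j with h | h | h
    · have : qc (Pi.single b (1 : ℝ)) (j + 1) = 0 := by
        unfold qc
        simp only [Nat.add_eq_zero_iff, one_ne_zero, and_false, if_false, Nat.add_sub_cancel]
        split_ifs with hj
        · rw [Pi.single_eq_of_ne]; intro hh; rw [Fin.ext_iff] at hh; simp at hh; omega
        · rfl
      rw [this, if_pos h, if_pos (by omega), ← pow_succ']
      simp; congr 1; omega
    · subst h
      simp [qc_succ]
    · have : qc (Pi.single b (1 : ℝ)) (j + 1) = 0 := by
        unfold qc
        simp only [Nat.add_eq_zero_iff, one_ne_zero, and_false, if_false, Nat.add_sub_cancel]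
        split_ifs with hj
        · rw [Pi.single_eq_of_ne]; intro hh; rw [Fin.ext_iff] at hh; simp at hh; omega
        · rfl
      rw [this, if_neg (by omega), if_neg (by omega)]; simp

theorem hornerDeriv_eq_sum (u : Fin n → ℝ) (j : ℕ) :
    hornerDeriv u j = ∑ a ∈ Finset.range j, C (qc u (a + 1)) * X ^ (j - 1 - a) := by
  induction j with
  | zero => simp [hornerDeriv]
  | succ j ih =>
    rw [hornerDeriv, ih, Finset.sum_range_succ, Finset.mul_sum]
    congr 1
    · refine Finset.sum_congr rfl fun a ha => ?_
      have := Finset.mem_range.1 ha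
      rw [show j + 1 - 1 - a = (j - 1 - a) + 1 by omega]; ring
    · simp

theorem hornerDeriv_self (u : Fin n → ℝ) : hornerDeriv u n = vecPoly u := by
  rw [hornerDeriv_eq_sum, vecPoly, Finset.sum_range]
  simp [qc_succ]

theorem vecPoly_degree_lt (v : Fin n → ℝ) : (vecPoly v).degree < n := by
  rw [degree_lt_iff_coeff_zero]
  intro k hk
  rw [vecPoly, finsetSum_coeff]
  refine Finset.sum_eq_zero fun a _ => ?_
  rw [coeff_C_mul, coeff_X_pow, if_neg (by omega), mul_zero]

theorem vecPoly_coeff (v : Fin n → ℝ) (a : Fin n) : (vecPoly v).coeff (n - 1 - a) = v a := by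
  rw [vecPoly, finsetSum_coeff, Finset.sum_eq_single a]
  · simp
  · intro b _ hb
    rw [coeff_C_mul, coeff_X_pow, if_neg, mul_zero]
    intro h; apply hb; ext; omega
  · simp

theorem vecPoly_injective : Function.Injective (vecPoly (n := n)) := by
  intro u v h
  ext a
  rw [← vecPoly_coeff u a, h, vecPoly_coeff]

theorem vecPoly_zero : vecPoly (0 : Fin n → ℝ) = 0 := by simp [vecPoly]

theorem vecPoly_add (u v : Fin n → ℝ) : vecPoly (u + v) = vecPoly u + vecPoly v := by
  simp [vecPoly, add_mul, Finset.sum_add_distrib]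

theorem vecPoly_smul (c : ℝ) (v : Fin n → ℝ) : vecPoly (c • v) = C c * vecPoly v := by
  simp [vecPoly, Finset.mul_sum, mul_assoc]

theorem vecPoly_sum {ι : Type*} (s : Finset ι) (v : ι → Fin n → ℝ) :
    vecPoly (∑ i ∈ s, v i) = ∑ i ∈ s, vecPoly (v i) := by
  classical
  induction s using Finset.induction_on with
  | empty => simp [vecPoly_zero]
  | insert a s ha ih => rw [Finset.sum_insert ha, vecPoly_add, ih, Finset.sum_insert ha]

theorem vecPoly_single (a : Fin n) : vecPoly (Pi.single a (1 : ℝ)) = X ^ (n - 1 - (a : ℕ)) := by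
  rw [vecPoly, Finset.sum_eq_single a]
  · simp
  · intro b _ hb; simp [Pi.single_eq_of_ne hb]
  · simp

theorem exists_vecPoly_eq {P : ℝ[X]} (h : P.degree < n) : ∃ v : Fin n → ℝ, vecPoly v = P := by
  refine ⟨fun a => P.coeff (n - 1 - a), ?_⟩
  ext k
  by_cases hk : k < n
  · have := vecPoly_coeff (n := n) (fun a => P.coeff (n - 1 - a)) ⟨n - 1 - k, by omega⟩
    simp only at this
    rwa [show n - 1 - (n - 1 - k) = k by omega] at this
  · rw [degree_lt_iff_coeff_zero] at h
    rw [h k (by omega)]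
    exact (degree_lt_iff_coeff_zero _ _).1 (vecPoly_degree_lt _) k (by omega)

theorem horner_eq_add (q : Fin n → ℝ) (j : ℕ) : horner q j = X ^ j + hornerDeriv q j := by
  induction j with
  | zero => simp [horner, hornerDeriv]
  | succ j ih => rw [horner, hornerDeriv, ih]; ring

theorem charPoly_eq (q : Fin n → ℝ) : charPoly q = X ^ n + vecPoly q := by
  rw [charPoly, horner_eq_add, hornerDeriv_self]

theorem exists_charPoly_eq {P : ℝ[X]} (hP : P.Monic) (h : P.natDegree = n) :
    ∃ q : Fin n → ℝ, charPoly q = P := by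
  have : (P - X ^ n).degree < (n : WithBot ℕ) := by
    have := degree_sub_lt_left (p := P) (q := X ^ n) (by
      rw [degree_X_pow, degree_eq_natDegree hP.ne_zero, h]) hP.ne_zero (by
      rw [hP.leadingCoeff]; simp)
    rwa [degree_eq_natDegree hP.ne_zero, h] at this
  obtain ⟨v, hv⟩ := exists_vecPoly_eq this
  exact ⟨v, by rw [charPoly_eq, hv]; ring⟩

theorem horner_degree_lt (q : Fin n → ℝ) (a : Fin n) : (horner q a).degree < n := by
  rw [horner_degree]; exact_mod_cast a.2

theorem momentumPoly_degree_lt (z : PhaseSpace n) : (momentumPoly z).degree < n := by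
  rw [momentumPoly, degree_neg]
  refine lt_of_le_of_lt (degree_sum_le _ _) ?_
  rw [Finset.sup_lt_iff (by exact_mod_cast WithBot.bot_lt_coe n)]
  intro a _
  refine lt_of_le_of_lt (degree_mul_le _ _) ?_
  refine lt_of_le_of_lt (add_le_add degree_C_le le_rfl) ?_
  rw [zero_add]; exact horner_degree_lt _ _

/-- The truncated Horner polynomials are a basis of the polynomials of degree `< m`. -/
theorem exists_sum_horner (q : Fin n → ℝ) (m : ℕ) {P : ℝ[X]} (h : P.degree < m) :
    ∃ c : Fin m → ℝ, P = ∑ a : Fin m, C (c a) * horner q a := by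
  induction m generalizing P with
  | zero =>
    refine ⟨fun _ => 0, ?_⟩
    rw [degree_lt_iff_coeff_zero] at h
    ext k; simp [h k]
  | succ m ih =>
    have : (P - C (P.coeff m) * horner q m).degree < (m : WithBot ℕ) := by
      rw [degree_lt_iff_coeff_zero] at h ⊢
      intro k hk
      rcases hk.eq_or_lt with rfl | hk
      · have := horner_monic q m
        rw [Monic, leadingCoeff, (horner_monic_natDegree q m).2] at this
        simp [this]
      · rw [coeff_sub, h k (by omega), coeff_C_mul,
          coeff_eq_zero_of_natDegree_lt (p := horner q m), mul_zero, sub_zero]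
        rwa [(horner_monic_natDegree q m).2]
    obtain ⟨c, hc⟩ := ih this
    refine ⟨Fin.snoc c (P.coeff m), ?_⟩
    rw [Fin.sum_univ_castSucc]
    simp only [Fin.snoc_castSucc, Fin.snoc_last, Fin.val_castSucc, Fin.val_last]
    rw [← hc]; ring

theorem exists_momentumPoly_eq (q : Fin n → ℝ) {P : ℝ[X]} (h : P.degree < n) :
    ∃ p : Fin n → ℝ, momentumPoly (q, p) = P := by
  obtain ⟨c, hc⟩ := exists_sum_horner q n h
  refine ⟨fun a => -c a, ?_⟩
  rw [hc]; simp [momentumPoly]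

/-- The truncated Horner polynomials are linearly independent, having distinct degrees. -/
theorem sum_horner_eq_zero (q : Fin n → ℝ) (m : ℕ) (c : Fin m → ℝ)
    (h : ∑ a : Fin m, C (c a) * horner q a = 0) : c = 0 := by
  induction m with
  | zero => exact Subsingleton.elim _ _
  | succ m ih =>
    rw [Fin.sum_univ_castSucc] at h
    simp only [Fin.val_castSucc, Fin.val_last] at h
    have h0 : c (Fin.last m) = 0 := by
      have := congrArg (fun P => P.coeff m) h
      simp only [coeff_add, finsetSum_coeff, coeff_zero] at this
      rw [Finset.sum_eq_zero] at this
      · have h1 := horner_monic q m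
        rw [Monic, leadingCoeff, (horner_monic_natDegree q m).2] at h1
        simpa [h1] using this
      · intro a _
        rw [coeff_C_mul, coeff_eq_zero_of_natDegree_lt, mul_zero]
        rw [(horner_monic_natDegree q a).2]; exact a.2
    have h1 := ih (fun a => c a.castSucc) (by simpa [h0] using h)
    ext a
    refine Fin.lastCases ?_ (fun a => ?_) a
    · exact h0
    · exact congrFun h1 a

/-- `X ^ (n - j) W = U T + S` with `deg S < n`, where `T = -∑_{a ≥ j} p_{a+1} X ^ (a - j)`. -/
theorem momentumPoly_div (z : PhaseSpace n) {j : ℕ} (hj : j ≤ n) :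
    (X ^ (n - j) * momentumPoly z - charPoly z.1 *
      (-∑ a : Fin n, if j ≤ (a : ℕ) then C (z.2 a) * X ^ ((a : ℕ) - j) else 0)).degree < (n : WithBot ℕ) := by
  have key : ∀ a : Fin n, (C (z.2 a) * (X ^ (n - j) * horner z.1 a -
      charPoly z.1 * (if j ≤ (a : ℕ) then X ^ ((a : ℕ) - j) else 0))).degree < (n : WithBot ℕ) := by
    intro a
    refine lt_of_le_of_lt (degree_mul_le _ _) ?_
    refine lt_of_le_of_lt (add_le_add degree_C_le le_rfl) ?_
    rw [zero_add]
    split_ifs with h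
    · obtain ⟨R, hR, hr⟩ := horner_add z.1 a (n - a)
      rw [show (a : ℕ) + (n - a) = n by omega] at hr
      rw [charPoly, hr, show (X ^ (n - j) * horner z.1 a -
        (X ^ (n - (a : ℕ)) * horner z.1 a + R) * X ^ ((a : ℕ) - j) : ℝ[X]) =
        X ^ (n - j) * horner z.1 a - (X ^ (n - (a : ℕ)) * X ^ ((a : ℕ) - j)) * horner z.1 a
          - X ^ ((a : ℕ) - j) * R by ring, ← pow_add,
        show n - (a : ℕ) + (a - j) = n - j by omega, sub_self, zero_sub, degree_neg]
      rw [degree_lt_iff_coeff_zero] at hR ⊢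
      intro k hk
      rw [coeff_X_pow_mul', if_pos (by omega), hR]
      omega
    · rw [mul_zero, sub_zero, degree_mul, degree_X_pow, horner_degree]
      norm_cast; omega
  have e : (X ^ (n - j) * momentumPoly z - charPoly z.1 *
      (-∑ a : Fin n, if j ≤ (a : ℕ) then C (z.2 a) * X ^ ((a : ℕ) - j) else 0)) =
      -∑ a : Fin n, (C (z.2 a) * (X ^ (n - j) * horner z.1 a -
      charPoly z.1 * (if j ≤ (a : ℕ) then X ^ ((a : ℕ) - j) else 0))) := by
    rw [momentumPoly, mul_neg, mul_neg, Finset.mul_sum, Finset.mul_sum, sub_neg_eq_add,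
      ← sub_eq_neg_add, ← neg_sub, ← Finset.sum_sub_distrib]
    congr 1
    refine Finset.sum_congr rfl fun a _ => ?_
    split_ifs <;> ring
  rw [e, degree_neg]
  refine lt_of_le_of_lt (degree_sum_le _ _) ?_
  rw [Finset.sup_lt_iff (by exact_mod_cast WithBot.bot_lt_coe n)]
  exact fun a _ => key a

theorem isCoprime_X_charPoly {q : Fin n → ℝ} (h : qc q n ≠ 0) : IsCoprime X (charPoly q) := by
  rw [← charPoly_eval_zero] at h
  have := (Polynomial.irreducible_X (R := ℝ)).coprime_iff_not_dvd.2
    (show ¬ X ∣ charPoly q by rw [X_dvd_iff, coeff_zero_eq_eval_zero]; exact h)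
  exact this

/-! ### Differentiating families of polynomials -/

section Calculus

variable {E : Type*} [NormedAddCommGroup E] [NormedSpace ℝ E]

/-- The family `P` of polynomials is coefficientwise differentiable at `z`, and `P'` is its
derivative in the direction `v`. -/
def HasPolyDerivAt (P : E → ℝ[X]) (P' : ℝ[X]) (z v : E) : Prop :=
  ∀ k, DifferentiableAt ℝ (fun w => (P w).coeff k) z ∧
    fderiv ℝ (fun w => (P w).coeff k) z v = P'.coeff k

variable {P R : E → ℝ[X]} {P' R' : ℝ[X]} {z v : E}

theorem hasPolyDerivAt_const (A : ℝ[X]) (z v : E) : HasPolyDerivAt (fun _ => A) 0 z v :=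
  fun k => ⟨differentiableAt_const _, by simp⟩

theorem hasPolyDerivAt_C {f : E → ℝ} (hf : DifferentiableAt ℝ f z) (v : E) :
    HasPolyDerivAt (fun w => C (f w)) (C (fderiv ℝ f z v)) z v := by
  intro k
  by_cases hk : k = 0
  · subst hk; simpa using hf
  · simp [coeff_C, hk]

theorem HasPolyDerivAt.add (hP : HasPolyDerivAt P P' z v) (hR : HasPolyDerivAt R R' z v) :
    HasPolyDerivAt (fun w => P w + R w) (P' + R') z v := by
  intro k
  simp only [coeff_add]
  refine ⟨(hP k).1.add (hR k).1, ?_⟩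
  rw [fderiv_fun_add (hP k).1 (hR k).1, ← (hP k).2, ← (hR k).2]; rfl

theorem HasPolyDerivAt.neg (hP : HasPolyDerivAt P P' z v) :
    HasPolyDerivAt (fun w => -P w) (-P') z v := by
  intro k
  simp only [coeff_neg]
  refine ⟨(hP k).1.neg, ?_⟩
  rw [fderiv_fun_neg, ← (hP k).2]; rfl

theorem HasPolyDerivAt.sub (hP : HasPolyDerivAt P P' z v) (hR : HasPolyDerivAt R R' z v) :
    HasPolyDerivAt (fun w => P w - R w) (P' - R') z v := by
  simpa only [sub_eq_add_neg] using hP.add hR.neg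

theorem HasPolyDerivAt.mul (hP : HasPolyDerivAt P P' z v) (hR : HasPolyDerivAt R R' z v) :
    HasPolyDerivAt (fun w => P w * R w) (P' * R z + P z * R') z v := by
  intro k
  simp only [coeff_mul, coeff_add]
  have h : HasFDerivAt (fun w => ∑ x ∈ Finset.HasAntidiagonal.antidiagonal k,
      (P w).coeff x.1 * (R w).coeff x.2) _ z :=
    HasFDerivAt.fun_sum fun x _ => ((hP x.1).1.hasFDerivAt.mul (hR x.2).1.hasFDerivAt)
  refine ⟨h.differentiableAt, ?_⟩
  rw [h.fderiv, _root_.sum_apply, ← Finset.sum_add_distrib]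
  refine Finset.sum_congr rfl fun x _ => ?_
  simp only [_root_.add_apply, _root_.smul_apply, smul_eq_mul, (hP x.1).2,
    (hR x.2).2]
  ring

theorem HasPolyDerivAt.sum {ι : Type*} {s : Finset ι} {P : ι → E → ℝ[X]} {P' : ι → ℝ[X]}
    (h : ∀ i ∈ s, HasPolyDerivAt (P i) (P' i) z v) :
    HasPolyDerivAt (fun w => ∑ i ∈ s, P i w) (∑ i ∈ s, P' i) z v := by
  classical
  induction s using Finset.induction_on with
  | empty => simpa using hasPolyDerivAt_const 0 z v
  | insert a s ha ih =>
    simp only [Finset.sum_insert ha]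
    exact (h a (Finset.mem_insert_self a s)).add
      (ih fun i hi => h i (Finset.mem_insert_of_mem hi))

theorem HasPolyDerivAt.congr (hP : HasPolyDerivAt P P' z v) (h : P =ᶠ[𝓝 z] R) :
    HasPolyDerivAt R P' z v := by
  intro k
  have : (fun w => (P w).coeff k) =ᶠ[𝓝 z] fun w => (R w).coeff k :=
    h.mono fun w hw => by simp only [hw]
  exact ⟨(this.differentiableAt_iff).1 (hP k).1, by rw [← this.fderiv_eq, (hP k).2]⟩

theorem HasPolyDerivAt.unique (hP : HasPolyDerivAt P P' z v) (hR : HasPolyDerivAt P R' z v) :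
    P' = R' := by
  ext k; rw [← (hP k).2, (hR k).2]

theorem exists_hasPolyDerivAt {M : ℕ} (hM : ∀ w, (P w).natDegree ≤ M)
    (hd : ∀ k, DifferentiableAt ℝ (fun w => (P w).coeff k) z) (v : E) :
    ∃ P', HasPolyDerivAt P P' z v := by
  refine ⟨∑ j ∈ Finset.range (M + 1), C (fderiv ℝ (fun w => (P w).coeff j) z v) * X ^ j,
    fun k => ⟨hd k, ?_⟩⟩
  rw [finsetSum_coeff]
  simp only [coeff_C_mul, coeff_X_pow, mul_ite, mul_one, mul_zero, Finset.sum_ite_eq,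
    Finset.mem_range]
  split_ifs with hk
  · rfl
  · have : (fun w => (P w).coeff k) = fun _ => 0 :=
      funext fun w => coeff_eq_zero_of_natDegree_lt ((hM w).trans_lt (by omega))
    simp [this]

/-- The ring of functions differentiable at `z`. A family of polynomials of bounded degree with
such coefficients is a polynomial over this ring, so that division with remainder can be done
there. -/
def differentiableSubring (z : E) : Subring (E → ℝ) where
  carrier := {f | DifferentiableAt ℝ f z}
  mul_mem' := fun ha hb => DifferentiableAt.mul ha hb
  one_mem' := differentiableAt_const _
  add_mem' := fun ha hb => DifferentiableAt.add ha hb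
  zero_mem' := differentiableAt_const _
  neg_mem' := fun ha => DifferentiableAt.neg ha

/-- Evaluation at `w` of the functions differentiable at `z`. -/
def evalAt (z w : E) : differentiableSubring z →+* ℝ :=
  (Pi.evalRingHom (fun _ : E => ℝ) w).comp (differentiableSubring z).subtype

theorem exists_lift {M : ℕ} (hM : ∀ w, (P w).natDegree ≤ M)
    (hd : ∀ k, DifferentiableAt ℝ (fun w => (P w).coeff k) z) :
    ∃ A : (differentiableSubring z)[X], A.natDegree ≤ M ∧ (∀ w, A.map (evalAt z w) = P w) := by
  refine ⟨∑ j ∈ Finset.range (M + 1), C (⟨fun w => (P w).coeff j, hd j⟩ : differentiableSubring z)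
    * X ^ j, ?_, fun w => ?_⟩
  · exact natDegree_sum_le_of_forall_le _ _ fun j hj =>
      (natDegree_C_mul_X_pow_le _ _).trans (by have := Finset.mem_range.1 hj; omega)
  · rw [Polynomial.map_sum]
    simp only [Polynomial.map_mul, map_C, Polynomial.map_pow, map_X]
    exact ((P w).as_sum_range_C_mul_X_pow' (Nat.lt_succ_of_le (hM w))).symm

/-- Quotient and remainder by a monic family of constant degree are again differentiable. -/
theorem differentiableAt_coeff_div {U : E → ℝ[X]} {M m : ℕ} (hM : ∀ w, (P w).natDegree ≤ M)
    (hP : ∀ k, DifferentiableAt ℝ (fun w => (P w).coeff k) z) (hU : ∀ w, (U w).Monic)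
    (hUm : ∀ w, (U w).natDegree = m)
    (hUd : ∀ k, DifferentiableAt ℝ (fun w => (U w).coeff k) z) (k : ℕ) :
    DifferentiableAt ℝ (fun w => (P w /ₘ U w).coeff k) z ∧
      DifferentiableAt ℝ (fun w => (P w %ₘ U w).coeff k) z := by
  obtain ⟨A, -, hA⟩ := exists_lift hM hP
  obtain ⟨B, hB, hBU⟩ := exists_lift (fun w => (hUm w).le) hUd
  have hBm : B.Monic := by
    refine monic_of_natDegree_le_of_coeff_eq_one m hB ?_
    ext w
    have : (U w).coeff m = 1 := by have := hU w; rwa [Monic, leadingCoeff, hUm] at this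
    rw [← hBU w, coeff_map] at this
    exact this
  have h1 : (fun w => (P w /ₘ U w).coeff k) = ((A /ₘ B).coeff k : E → ℝ) := by
    funext w
    rw [← hA, ← hBU, ← map_divByMonic _ hBm, coeff_map]; rfl
  have h2 : (fun w => (P w %ₘ U w).coeff k) = ((A %ₘ B).coeff k : E → ℝ) := by
    funext w
    rw [← hA, ← hBU, ← map_modByMonic _ hBm, coeff_map]; rfl
  rw [h1, h2]
  exact ⟨((A /ₘ B).coeff k).2, ((A %ₘ B).coeff k).2⟩

end Calculus


/-- The derivative of `momentumPoly` at `z` in the direction `v`. -/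
def momentumDeriv (z v : PhaseSpace n) : ℝ[X] :=
  -∑ a : Fin n, (C (v.2 a) * horner z.1 a + C (z.2 a) * hornerDeriv v.1 a)

theorem hasFDerivAt_position (a : Fin n) (z : PhaseSpace n) :
    HasFDerivAt (fun w : PhaseSpace n => w.1 a)
      ((ContinuousLinearMap.proj a).comp (ContinuousLinearMap.fst ℝ (Fin n → ℝ) (Fin n → ℝ))) z :=
  ((ContinuousLinearMap.proj a).comp
    (ContinuousLinearMap.fst ℝ (Fin n → ℝ) (Fin n → ℝ))).hasFDerivAt

theorem hasFDerivAt_momentum (a : Fin n) (z : PhaseSpace n) :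
    HasFDerivAt (fun w : PhaseSpace n => w.2 a)
      ((ContinuousLinearMap.proj a).comp (ContinuousLinearMap.snd ℝ (Fin n → ℝ) (Fin n → ℝ))) z :=
  ((ContinuousLinearMap.proj a).comp
    (ContinuousLinearMap.snd ℝ (Fin n → ℝ) (Fin n → ℝ))).hasFDerivAt

theorem differentiableAt_qc (j : ℕ) (z : PhaseSpace n) :
    DifferentiableAt ℝ (fun w : PhaseSpace n => qc w.1 j) z := by
  unfold qc
  split_ifs with h0 h1
  · exact differentiableAt_const _
  · exact (hasFDerivAt_position _ z).differentiableAt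
  · exact differentiableAt_const _

theorem fderiv_qc_succ (j : ℕ) (z v : PhaseSpace n) :
    fderiv ℝ (fun w : PhaseSpace n => qc w.1 (j + 1)) z v = qc v.1 (j + 1) := by
  unfold qc
  simp only [Nat.add_eq_zero_iff, one_ne_zero, and_false, if_false, Nat.add_sub_cancel]
  split_ifs with h1
  · rw [(hasFDerivAt_position _ z).fderiv]; rfl
  · simp

theorem hasPolyDerivAt_horner (j : ℕ) (z v : PhaseSpace n) :
    HasPolyDerivAt (fun w : PhaseSpace n => horner w.1 j) (hornerDeriv v.1 j) z v := by
  induction j with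
  | zero => exact hasPolyDerivAt_const _ z v
  | succ j ih =>
    simp only [horner, hornerDeriv]
    have h := ((hasPolyDerivAt_const X z v).mul ih).add
      (hasPolyDerivAt_C (differentiableAt_qc (j + 1) z) v)
    rw [fderiv_qc_succ] at h
    simpa using h

theorem hasPolyDerivAt_charPoly (z v : PhaseSpace n) :
    HasPolyDerivAt (fun w : PhaseSpace n => charPoly w.1) (vecPoly v.1) z v := by
  rw [← hornerDeriv_self]; exact hasPolyDerivAt_horner n z v

theorem hasPolyDerivAt_momentumPoly (z v : PhaseSpace n) :
    HasPolyDerivAt momentumPoly (momentumDeriv z v) z v := by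
  refine HasPolyDerivAt.neg (HasPolyDerivAt.sum fun a _ => ?_)
  have h := (hasPolyDerivAt_C (hasFDerivAt_momentum a z).differentiableAt v).mul
    (hasPolyDerivAt_horner a z v)
  rw [(hasFDerivAt_momentum a z).fderiv] at h
  exact h

theorem hasPolyDerivAt_vecPoly {H : PhaseSpace n → Fin n → ℝ} {z : PhaseSpace n}
    (hH : ∀ r, DifferentiableAt ℝ (fun w => H w r) z) (v : PhaseSpace n) :
    HasPolyDerivAt (fun w => vecPoly (H w)) (vecPoly fun r => fderiv ℝ (fun w => H w r) z v) z v := by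
  refine HasPolyDerivAt.sum fun a _ => ?_
  simpa using (hasPolyDerivAt_C (hH a) v).mul (hasPolyDerivAt_const (X ^ (n - 1 - (a : ℕ))) z v)

/-- The relation `x ^ e H ≡ ½ x ^ m W² + Ψ` modulo `charPoly`, where `H` is the polynomial with
coefficients `H_1, …, H_n`. -/
def SeparationRelation (e m : ℕ) (Ψ : ℝ[X]) (H : PhaseSpace n → Fin n → ℝ) (w : PhaseSpace n) :
    Prop :=
  charPoly w.1 ∣ X ^ e * vecPoly (H w) - (C (1 / 2) * X ^ m * momentumPoly w ^ 2 + Ψ)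

theorem natDegree_le_of_degree_lt {p : ℝ[X]} {m : ℕ} (h : p.degree < m) : p.natDegree ≤ m :=
  natDegree_le_of_degree_le h.le

/-- The separation relation may be differentiated: with `Q` the quotient in the relation, every
derivative of `x ^ e H` is congruent to `x ^ m W W' - Q U'`. The derivative of `Q` drops out
modulo `charPoly`. -/
theorem SeparationRelation.deriv {e m : ℕ} {Ψ : ℝ[X]} {H : PhaseSpace n → Fin n → ℝ}
    {z : PhaseSpace n} (hH : ∀ r, DifferentiableAt ℝ (fun w => H w r) z)
    (h : ∀ᶠ w in 𝓝 z, SeparationRelation e m Ψ H w) :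
    ∃ Q : ℝ[X],
      X ^ e * vecPoly (H z) = C (1 / 2) * X ^ m * momentumPoly z ^ 2 + Ψ - charPoly z.1 * Q ∧
      ∀ v : PhaseSpace n, charPoly z.1 ∣ X ^ e * vecPoly (fun r => fderiv ℝ (fun w => H w r) z v) -
        (X ^ m * momentumPoly z * momentumDeriv z v - Q * vecPoly v.1) := by
  set P : PhaseSpace n → ℝ[X] := fun w =>
    C (1 / 2) * X ^ m * momentumPoly w ^ 2 + Ψ - X ^ e * vecPoly (H w) with hPdef
  have hPd : ∀ v, HasPolyDerivAt P (X ^ m * momentumPoly z * momentumDeriv z v -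
      X ^ e * vecPoly (fun r => fderiv ℝ (fun w => H w r) z v)) z v := by
    intro v
    have h1 := hasPolyDerivAt_momentumPoly z v
    have h2 := (((hasPolyDerivAt_const (C (1 / 2) * X ^ m) z v).mul (h1.mul h1)).add
      (hasPolyDerivAt_const Ψ z v)).sub
      ((hasPolyDerivAt_const (X ^ e) z v).mul (hasPolyDerivAt_vecPoly hH v))
    have hc : (C (1 / 2) : ℝ[X]) + C (1 / 2) = 1 := by rw [← C_add]; norm_num
    convert h2 using 1
    · funext w; simp only [hPdef]; ring
    · linear_combination (-X ^ m * momentumPoly z * momentumDeriv z v) * hc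
  have hdegP : ∀ w, (P w).natDegree ≤ m + 2 * n + Ψ.natDegree + e + n := by
    intro w
    have hW : (momentumPoly w).natDegree ≤ n := natDegree_le_of_degree_lt (momentumPoly_degree_lt w)
    have hH' : (vecPoly (H w)).natDegree ≤ n := natDegree_le_of_degree_lt (vecPoly_degree_lt _)
    refine (natDegree_sub_le _ _).trans (max_le ((natDegree_add_le _ _).trans (max_le ?_ ?_)) ?_)
    · refine natDegree_mul_le.trans ?_
      have a1 : (C (1 / 2) * X ^ m : ℝ[X]).natDegree ≤ m := natDegree_C_mul_X_pow_le _ _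
      have a2 : (momentumPoly w ^ 2).natDegree ≤ 2 * (momentumPoly w).natDegree :=
        natDegree_pow_le
      omega
    · omega
    · refine natDegree_mul_le.trans ?_
      rw [natDegree_X_pow]; omega
  have hQd := fun k => (differentiableAt_coeff_div (U := fun w : PhaseSpace n => charPoly w.1) hdegP
    (fun k => (hPd 0 k).1) (fun w => charPoly_monic w.1) (fun w => charPoly_natDegree w.1)
    (fun k => (hasPolyDerivAt_charPoly z 0 k).1) k).1
  have hev : ∀ᶠ w in 𝓝 z, P w = charPoly w.1 * (P w /ₘ charPoly w.1) := by
    refine h.mono fun w hw => ?_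
    have hdvd : charPoly w.1 ∣ P w := by
      rw [SeparationRelation, ← neg_sub, dvd_neg] at hw
      exact hw
    have := modByMonic_add_div (P w) (charPoly w.1)
    rw [(modByMonic_eq_zero_iff_dvd (charPoly_monic w.1)).2 hdvd, zero_add] at this
    exact this.symm
  refine ⟨P z /ₘ charPoly z.1, ?_, fun v => ?_⟩
  · have := hev.self_of_nhds
    rw [← this]; simp only [hPdef]; ring
  · obtain ⟨Q', hQ'⟩ := exists_hasPolyDerivAt (P := fun w => P w /ₘ charPoly w.1)
      (M := m + 2 * n + Ψ.natDegree + e + n) (fun w => by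
        rw [natDegree_divByMonic _ (charPoly_monic w.1)]
        exact (Nat.sub_le _ _).trans (hdegP w)) hQd v
    have h1 := (hPd v).congr hev
    have h2 := (hasPolyDerivAt_charPoly z v).mul hQ'
    have h3 := h1.unique h2
    refine ⟨-Q', ?_⟩
    linear_combination -h3

/-! ### Involution from a separation relation -/

theorem aeval_vecPoly {B : Type*} [CommRing B] [Algebra ℝ B] (ξ : B) (v : Fin n → ℝ) :
    aeval ξ (vecPoly v) = ∑ a : Fin n, algebraMap ℝ B (v a) * ξ ^ (n - 1 - (a : ℕ)) := by
  simp [vecPoly]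

theorem eq_zero_of_charPoly_dvd {q : Fin n → ℝ} {P : ℝ[X]} (hP : P.degree < n)
    (h : charPoly q ∣ P) : P = 0 :=
  eq_zero_of_dvd_of_degree_lt h (by rwa [charPoly_degree])

/-- The monomials `ξ ^ a η ^ b`, `a, b < n`, in two independent roots of `charPoly q` are linearly
independent. -/
theorem eq_zero_of_forall_roots (q : Fin n → ℝ) (c : Fin n → Fin n → ℝ)
    (h : ∀ (B : Type) [CommRing B] [Algebra ℝ B] (ξ η : B), aeval ξ (charPoly q) = 0 →
      aeval η (charPoly q) = 0 →
      ∑ a : Fin n, ∑ b : Fin n, algebraMap ℝ B (c a b) * ξ ^ (n - 1 - (a : ℕ)) *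
        η ^ (n - 1 - (b : ℕ)) = 0) (a b : Fin n) : c a b = 0 := by
  have hU := charPoly_monic q
  let A := AdjoinRoot (charPoly q)
  have : Nontrivial A := AdjoinRoot.nontrivial _ (by
    rw [charPoly_degree]; have := a.pos; exact_mod_cast this.ne')
  let V : A[X] := (charPoly q).map (algebraMap ℝ A)
  have hV : V.Monic := hU.map _
  have hVdeg : V.degree = n := by
    rw [hU.degree_map, charPoly_degree]
  let B := AdjoinRoot V
  let ξ : B := AdjoinRoot.of V (AdjoinRoot.root (charPoly q))
  let η : B := AdjoinRoot.root V
  have hξ : aeval ξ (charPoly q) = 0 := by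
    have h1 : ξ = algebraMap A B (AdjoinRoot.root (charPoly q)) := rfl
    rw [h1, aeval_algebraMap_apply, AdjoinRoot.aeval_eq, AdjoinRoot.mk_self, map_zero]
  have hη : aeval η (charPoly q) = 0 := by
    have h1 : aeval η V = 0 := by rw [AdjoinRoot.aeval_eq, AdjoinRoot.mk_self]
    rwa [aeval_map_algebraMap] at h1
  have h0 := h B ξ η hξ hη
  let R : A[X] := ∑ b : Fin n, C (AdjoinRoot.mk (charPoly q) (vecPoly fun a => c a b)) *
    X ^ (n - 1 - (b : ℕ))
  have hRdeg : R.degree < n := by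
    refine lt_of_le_of_lt (degree_sum_le _ _) ?_
    rw [Finset.sup_lt_iff (by exact_mod_cast WithBot.bot_lt_coe n)]
    intro b _
    refine lt_of_le_of_lt (degree_C_mul_X_pow_le _ _) ?_
    exact_mod_cast (by have := b.2; omega : n - 1 - (b : ℕ) < n)
  have hR : AdjoinRoot.mk V R = 0 := by
    rw [← h0, Finset.sum_comm]
    simp only [R, map_sum, map_mul, map_pow]
    refine Finset.sum_congr rfl fun b _ => ?_
    have h1 : AdjoinRoot.mk V (C (AdjoinRoot.mk (charPoly q) (vecPoly fun a => c a b))) =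
        aeval ξ (vecPoly fun a => c a b) := by
      have h2 : ξ = algebraMap A B (AdjoinRoot.root (charPoly q)) := rfl
      rw [h2, aeval_algebraMap_apply, AdjoinRoot.aeval_eq]; rfl
    rw [h1, aeval_vecPoly, Finset.sum_mul]
    rfl
  rw [AdjoinRoot.mk_eq_zero] at hR
  have hR0 : R = 0 := by
    rw [← (modByMonic_eq_zero_iff_dvd hV).2 hR, (modByMonic_eq_self_iff hV).2 (by rwa [hVdeg])]
  have hcb : AdjoinRoot.mk (charPoly q) (vecPoly fun a => c a b) = 0 := by
    have := congrArg (fun P => P.coeff (n - 1 - (b : ℕ))) hR0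
    simp only [R, finsetSum_coeff, coeff_C_mul, coeff_X_pow, coeff_zero] at this
    rw [Finset.sum_eq_single b] at this
    · rw [if_pos rfl, mul_one] at this
      exact this
    · intro b' _ hb
      rw [if_neg, mul_zero]
      intro h; apply hb; ext; omega
    · simp
  rw [AdjoinRoot.mk_eq_zero] at hcb
  have h3 := eq_zero_of_charPoly_dvd (vecPoly_degree_lt _) hcb
  have h4 : (fun a => c a b) = 0 := vecPoly_injective (h3.trans vecPoly_zero.symm)
  exact congrFun h4 a

section Divided

variable {B : Type*} [CommRing B] [Algebra ℝ B]

/-- The divided difference `(h_j(ξ) - h_j(η)) / (ξ - η)`, written without a division because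
`ξ - η` may be a zero divisor. -/
def dividedHorner (q : Fin n → ℝ) (ξ η : B) (j : ℕ) : B :=
  ∑ b ∈ Finset.range j, ξ ^ (j - 1 - b) * aeval η (horner q b)

theorem dividedHorner_succ (q : Fin n → ℝ) (ξ η : B) (j : ℕ) :
    dividedHorner q ξ η (j + 1) = ξ * dividedHorner q ξ η j + aeval η (horner q j) := by
  rw [dividedHorner, dividedHorner, Finset.sum_range_succ, Finset.mul_sum]
  congr 1
  · refine Finset.sum_congr rfl fun b hb => ?_
    have := Finset.mem_range.1 hb
    rw [show j + 1 - 1 - b = (j - 1 - b) + 1 by omega]; ring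
  · simp

theorem sub_mul_dividedHorner (q : Fin n → ℝ) (ξ η : B) (j : ℕ) :
    (ξ - η) * dividedHorner q ξ η j = aeval ξ (horner q j) - aeval η (horner q j) := by
  induction j with
  | zero => simp [dividedHorner, horner]
  | succ j ih =>
    rw [dividedHorner_succ]
    simp only [horner, map_add, map_mul, aeval_X, aeval_C]
    linear_combination ξ * ih

theorem dividedHorner_comm (q : Fin n → ℝ) (ξ η : B) (j : ℕ) :
    dividedHorner q ξ η j = dividedHorner q η ξ j := by
  induction j with
  | zero => simp [dividedHorner]
  | succ j ih =>
    have h := sub_mul_dividedHorner q ξ η j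
    rw [dividedHorner_succ, dividedHorner_succ, ← ih]
    linear_combination h

theorem sum_fin_eq_dividedHorner (q : Fin n → ℝ) (ξ η : B) {j : ℕ} (hj : j ≤ n) :
    (∑ b : Fin n, (if (b : ℕ) < j then ξ ^ (j - 1 - (b : ℕ)) else 0) * aeval η (horner q b)) =
      dividedHorner q ξ η j := by
  rw [dividedHorner, Fin.sum_univ_eq_sum_range (fun b => (if b < j then ξ ^ (j - 1 - b) else 0) *
    aeval η (horner q b))]
  rw [← Finset.sum_subset (Finset.range_subset_range.2 hj)]
  · refine Finset.sum_congr rfl fun b hb => ?_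
    rw [if_pos (Finset.mem_range.1 hb)]
  · intro b _ hb
    rw [if_neg (by simpa using hb), zero_mul]

end Divided

theorem momentumDeriv_momentum (z : PhaseSpace n) (b : Fin n) :
    momentumDeriv z (0, Pi.single b 1) = -horner z.1 b := by
  have h0 : ∀ j, hornerDeriv (0 : Fin n → ℝ) j = 0 := fun j => by
    rw [hornerDeriv_eq_sum]; simp [qc]
  simp only [momentumDeriv, h0]
  rw [Finset.sum_eq_single b]
  · simp
  · intro a _ ha; simp [Pi.single_eq_of_ne ha]
  · simp

theorem momentumDeriv_position (z : PhaseSpace n) (b : Fin n) :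
    momentumDeriv z (Pi.single b 1, 0) =
      -∑ a : Fin n, C (z.2 a) * (if (b : ℕ) < a then X ^ ((a : ℕ) - 1 - (b : ℕ)) else 0) := by
  simp only [momentumDeriv, hornerDeriv_single]
  simp

/-- As the right-hand side is symmetric in `ξ` and `η`, this says that `{W(ξ), W(η)} = 0`. -/
theorem sum_momentumDeriv_mul_horner {B : Type*} [CommRing B] [Algebra ℝ B] (z : PhaseSpace n)
    (ξ η : B) :
    ∑ b : Fin n, aeval ξ (momentumDeriv z (Pi.single b 1, 0)) * aeval η (horner z.1 b) =
      -∑ a : Fin n, algebraMap ℝ B (z.2 a) * dividedHorner z.1 ξ η a := by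
  simp_rw [momentumDeriv_position, map_neg, map_sum, neg_mul, Finset.sum_neg_distrib,
    Finset.sum_mul]
  rw [Finset.sum_comm]
  congr 1
  refine Finset.sum_congr rfl fun a _ => ?_
  rw [← sum_fin_eq_dividedHorner z.1 ξ η a.2.le, Finset.mul_sum]
  refine Finset.sum_congr rfl fun b _ => ?_
  split_ifs <;> simp [mul_assoc]

/-- Functions linked to `U` and `W` by a separation relation are in involution. -/
theorem poissonBracket_eq_zero_of_separationRelation {e m : ℕ} {Ψ : ℝ[X]}
    {H : PhaseSpace n → Fin n → ℝ} {z : PhaseSpace n} (hq : qc z.1 n ≠ 0)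
    (hH : ∀ r, DifferentiableAt ℝ (fun w => H w r) z)
    (h : ∀ᶠ w in 𝓝 z, SeparationRelation e m Ψ H w) (r s : Fin n) :
    poissonBracket (fun w => H w r) (fun w => H w s) z = 0 := by
  obtain ⟨Q, -, hQ⟩ := SeparationRelation.deriv hH h
  refine eq_zero_of_forall_roots z.1
    (fun r s => poissonBracket (fun w => H w r) (fun w => H w s) z) ?_ r s
  intro B _ _ ξ η hξ hη
  -- the derivatives of `H` along the coordinate directions, as polynomials
  set hqv : Fin n → ℝ[X] := fun j => vecPoly fun r => fderiv ℝ (fun w => H w r) z (Pi.single j 1, 0)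
    with hqv_def
  set hpv : Fin n → ℝ[X] := fun j => vecPoly fun r => fderiv ℝ (fun w => H w r) z (0, Pi.single j 1)
    with hpv_def
  have root : ∀ (x : B), aeval x (charPoly z.1) = 0 → ∀ v : PhaseSpace n,
      x ^ e * aeval x (vecPoly fun r => fderiv ℝ (fun w => H w r) z v) =
        x ^ m * aeval x (momentumPoly z) * aeval x (momentumDeriv z v) -
          aeval x Q * aeval x (vecPoly v.1) := by
    intro x hx v
    obtain ⟨T, hT⟩ := hQ v
    have := congrArg (aeval x) hT
    rw [map_mul, hx, zero_mul] at this
    simp only [map_sub, map_mul, map_pow, aeval_X] at this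
    exact sub_eq_zero.1 this
  have unit : ∀ (x : B), aeval x (charPoly z.1) = 0 → IsUnit x := by
    intro x hx
    obtain ⟨A, D, hAD⟩ := isCoprime_X_charPoly hq
    have := congrArg (aeval x) hAD
    simp only [map_add, map_mul, aeval_X, hx, mul_zero, add_zero, map_one] at this
    exact IsUnit.of_mul_eq_one_right _ this
  have hqr : ∀ (x : B), aeval x (charPoly z.1) = 0 → ∀ j, x ^ e * aeval x (hqv j) =
      x ^ m * aeval x (momentumPoly z) * aeval x (momentumDeriv z (Pi.single j 1, 0)) -
        aeval x Q * x ^ (n - 1 - (j : ℕ)) := by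
    intro x hx j
    rw [hqv_def, root x hx]; simp [vecPoly_single]
  have hpr : ∀ (x : B), aeval x (charPoly z.1) = 0 → ∀ j, x ^ e * aeval x (hpv j) =
      -(x ^ m * aeval x (momentumPoly z) * aeval x (horner z.1 j)) := by
    intro x hx j
    rw [hpv_def, root x hx, momentumDeriv_momentum]
    simp only [vecPoly_zero]; simp
  have hsum : (∑ a : Fin n, ∑ b : Fin n,
      algebraMap ℝ B (poissonBracket (fun w => H w a) (fun w => H w b) z) *
      ξ ^ (n - 1 - (a : ℕ)) * η ^ (n - 1 - (b : ℕ))) =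
      ∑ j : Fin n, (aeval ξ (hqv j) * aeval η (hpv j) - aeval ξ (hpv j) * aeval η (hqv j)) := by
    simp only [hqv_def, hpv_def, aeval_vecPoly, poissonBracket, map_sum, map_sub, map_mul,
      Finset.sum_mul]
    rw [Finset.sum_congr rfl fun a _ => Finset.sum_comm, Finset.sum_comm]
    refine Finset.sum_congr rfl fun j _ => ?_
    rw [← Finset.sum_sub_distrib]
    refine Finset.sum_congr rfl fun a _ => ?_
    rw [Finset.mul_sum, Finset.mul_sum, ← Finset.sum_sub_distrib]
    refine Finset.sum_congr rfl fun b _ => ?_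
    ring
  rw [hsum]
  refine ((unit ξ hξ).pow e).mul_right_eq_zero.1 (((unit η hη).pow e).mul_right_eq_zero.1 ?_)
  have e1 : η ^ e * (ξ ^ e * ∑ j : Fin n, (aeval ξ (hqv j) * aeval η (hpv j) -
      aeval ξ (hpv j) * aeval η (hqv j))) =
      ∑ j : Fin n, ((ξ ^ e * aeval ξ (hqv j)) * (η ^ e * aeval η (hpv j)) -
      (ξ ^ e * aeval ξ (hpv j)) * (η ^ e * aeval η (hqv j))) := by
    rw [Finset.mul_sum, Finset.mul_sum]
    refine Finset.sum_congr rfl fun j _ => ?_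
    ring
  rw [e1]
  simp only [hqr ξ hξ, hqr η hη, hpr ξ hξ, hpr η hη]
  set g : ℝ[X] := X ^ m * momentumPoly z with hg
  have hgx : ∀ x : B, x ^ m * aeval x (momentumPoly z) = aeval x g := fun x => by simp [hg]
  simp only [hgx]
  have e2 : ∀ j : Fin n,
      ((aeval ξ g * aeval ξ (momentumDeriv z (Pi.single j 1, 0)) -
        aeval ξ Q * ξ ^ (n - 1 - (j : ℕ))) * -(aeval η g * aeval η (horner z.1 j)) -
      -(aeval ξ g * aeval ξ (horner z.1 j)) *
        (aeval η g * aeval η (momentumDeriv z (Pi.single j 1, 0)) -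
        aeval η Q * η ^ (n - 1 - (j : ℕ)))) =
      aeval ξ g * aeval η g * (aeval η (momentumDeriv z (Pi.single j 1, 0)) * aeval ξ (horner z.1 j)
        - aeval ξ (momentumDeriv z (Pi.single j 1, 0)) * aeval η (horner z.1 j)) +
      (aeval ξ Q * aeval η g * (ξ ^ (n - 1 - (j : ℕ)) * aeval η (horner z.1 j)) -
        aeval η Q * aeval ξ g * (η ^ (n - 1 - (j : ℕ)) * aeval ξ (horner z.1 j))) := fun j => by ring
  have e3 : ∀ x y : B, ∑ j : Fin n, x ^ (n - 1 - (j : ℕ)) * aeval y (horner z.1 j) =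
      dividedHorner z.1 x y n := by
    intro x y
    rw [← sum_fin_eq_dividedHorner z.1 x y le_rfl]
    simp
  simp only [e2, Finset.sum_add_distrib, ← Finset.mul_sum, Finset.sum_sub_distrib,
    sum_momentumDeriv_mul_horner, e3]
  have e4 := sub_mul_dividedHorner z.1 ξ η n
  rw [← charPoly, hξ, hη, sub_zero] at e4
  -- the antisymmetric factor `Q(ξ) g(η) - Q(η) g(ξ)` is divisible by `ξ - η`, which is annihilated
  -- by the divided difference of `U` at the roots `ξ` and `η`
  obtain ⟨cg, hcg⟩ := sub_dvd_eval_sub ξ η (g.map (algebraMap ℝ B))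
  obtain ⟨cQ, hcQ⟩ := sub_dvd_eval_sub ξ η (Q.map (algebraMap ℝ B))
  simp only [eval_map_algebraMap] at hcg hcQ
  have e5 : ∀ a : Fin n, dividedHorner z.1 η ξ (a : ℕ) = dividedHorner z.1 ξ η a := fun a =>
    dividedHorner_comm _ _ _ _
  simp only [e5, sub_self, mul_zero, zero_add]
  rw [dividedHorner_comm z.1 η ξ n]
  linear_combination (dividedHorner z.1 ξ η n * aeval η g) * hcQ -
    (dividedHorner z.1 ξ η n * aeval η Q) * hcg + (cQ * aeval η g - cg * aeval η Q) * e4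

/-! ### Polynomial identities behind the quadratic integrals -/

theorem natDegree_le_pred {P : ℝ[X]} {m : ℕ} (hm : 0 < m) (h : P.degree < m) :
    P.natDegree ≤ m - 1 := by
  by_cases hP : P = 0
  · simp [hP]
  · have := (natDegree_lt_iff_degree_lt hP).2 h
    omega

/-- The algebra behind the quadratic integrals: `F` stands for the derivative of `H` along a flow
with `U' = κ x ^ e` and `W' = Z`. The hypotheses determine the difference of the two sides modulo
`U ^ 2` only, but its degree is less than `2 n`. -/
theorem bracket_identity {q : Fin n → ℝ} (hn : 0 < n) (hq : qc q n ≠ 0) {κ : ℝ} {e f : ℕ}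
    {W S T Q Z H F Ψ : ℝ[X]} (hS : X ^ f * W = charPoly q * T + S) (hSd : S.degree < n)
    (hHd : H.degree < n) (hFd : F.degree < n) (he : e + 1 ≤ n) (hef : e ≤ f)
    (hΨ : Ψ.natDegree ≤ 2 * n - 2)
    (hH : X ^ e * H = C (1 / 2) * X ^ (2 * f) * W ^ 2 + Ψ - charPoly q * Q)
    (hF : charPoly q ∣ X ^ e * F - (X ^ (2 * f) * W * Z - Q * (C κ * X ^ e)))
    (hZ : charPoly q ∣ X ^ (f - e) * Z - C κ * T) :
    C κ * (C (1 / 2) * S ^ 2 + Ψ) = C κ * X ^ e * H - charPoly q * F ∧ F.coeff (n - 1) = 0 := by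
  have hc : (C (1 / 2) : ℝ[X]) + C (1 / 2) = 1 := by rw [← C_add]; norm_num
  set U := charPoly q with hU
  set Br : ℝ[X] := C κ * Q - C κ * X ^ f * W * T + F + C (1 / 2) * C κ * U * T ^ 2 with hBr
  have hS' : S = X ^ f * W - U * T := by rw [hS]; ring
  have e1 : C κ * (C (1 / 2) * S ^ 2 + Ψ - X ^ e * H) + U * F = U * Br := by
    rw [hS', hH, hBr, show 2 * f = f * 2 by ring, pow_mul]
    linear_combination (-C κ * X ^ f * W * U * T) * hc
  have e2 : U ∣ X ^ e * Br := by
    obtain ⟨a, ha⟩ := hF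
    obtain ⟨b, hb⟩ := hZ
    refine ⟨a + X ^ (f + e) * W * b + C (1 / 2) * C κ * X ^ e * T ^ 2, ?_⟩
    have h2 : (X : ℝ[X]) ^ (2 * f) = X ^ (f + e) * X ^ (f - e) := by
      rw [← pow_add]; congr 1; omega
    rw [hBr]
    rw [h2] at ha
    rw [pow_add] at ha ⊢
    linear_combination ha + X ^ f * X ^ e * W * hb
  -- `x` is invertible modulo `U`, so the factor `x ^ e` can be removed
  have e3 : U ∣ Br :=
    (((isCoprime_X_charPoly hq).pow_left (m := e)).symm).dvd_of_dvd_mul_left e2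
  obtain ⟨D, hD⟩ := e3
  have dS := natDegree_le_pred hn hSd
  have dH := natDegree_le_pred hn hHd
  have dF := natDegree_le_pred hn hFd
  have dU : U.natDegree = n := charPoly_natDegree q
  have dK : (C κ * (C (1 / 2) * S ^ 2 + Ψ - X ^ e * H)).natDegree ≤ 2 * n - 2 := by
    refine (natDegree_C_mul_le _ _).trans ((natDegree_sub_le _ _).trans
      (max_le ((natDegree_add_le _ _).trans (max_le ?_ hΨ)) ?_))
    · refine (natDegree_C_mul_le _ _).trans (natDegree_pow_le.trans ?_)
      omega
    · refine natDegree_mul_le.trans ?_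
      rw [natDegree_X_pow]; omega
  have hUm : U.Monic := charPoly_monic q
  -- a nonzero multiple of `U ^ 2` has degree at least `2 n`
  have e4 : D = 0 := by
    by_contra hD0
    have h1 : (U * (U * D)).natDegree = n + (n + D.natDegree) := by
      rw [hUm.natDegree_mul' (by rw [Ne, hUm.mul_right_eq_zero_iff]; exact hD0),
        hUm.natDegree_mul' hD0, dU]
    have h2 : (U * (U * D)).natDegree ≤ 2 * n - 1 := by
      rw [← hD, ← e1]
      refine (natDegree_add_le _ _).trans (max_le (dK.trans (by omega)) ?_)
      exact natDegree_mul_le.trans (by omega)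
    omega
  rw [hD, e4, mul_zero, mul_zero] at e1
  refine ⟨by linear_combination e1, ?_⟩
  have h5 : (U * F).coeff (n + (n - 1)) = U.coeff n * F.coeff (n - 1) :=
    coeff_mul_add_eq_of_natDegree_le dU.le dF
  have h6 : U.coeff n = 1 := by rw [← dU]; exact hUm
  rw [h6, one_mul] at h5
  rw [← h5, show U * F = -(C κ * (C (1 / 2) * S ^ 2 + Ψ - X ^ e * H)) by linear_combination e1,
    coeff_neg, coeff_eq_zero_of_natDegree_lt (lt_of_le_of_lt dK (by omega)), neg_zero]

theorem exists_mul_modByMonic_eq {q : Fin n → ℝ} (hq : qc q n ≠ 0) (f : ℕ) {S : ℝ[X]}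
    (hS : S.degree < n) : ∃ W : ℝ[X], W.degree < n ∧ (X ^ f * W) %ₘ charPoly q = S := by
  obtain ⟨a, b, hab⟩ := (isCoprime_X_charPoly hq).pow_left (m := f)
  have hU := charPoly_monic q
  refine ⟨(a * S) %ₘ charPoly q, ?_, ?_⟩
  · have := degree_modByMonic_lt (a * S) hU
    rwa [charPoly_degree] at this
  · conv_rhs => rw [← (modByMonic_eq_self_iff hU).2 (by rwa [charPoly_degree] : S.degree < _)]
    apply modByMonic_eq_of_dvd_sub hU
    have h1 := dvd_modByMonic_sub (a * S) (charPoly q)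
    obtain ⟨c, hc⟩ := h1
    exact ⟨X ^ f * c - b * S, by linear_combination X ^ f * hc + S * hab⟩

/-- The polynomial `(x - 1) ^ (n - 1) (x - r)` is a characteristic polynomial; its sign at `0`
is controlled by `r`. -/
theorem exists_charPoly_eq_test (hn : 0 < n) (r : ℝ) :
    ∃ q : Fin n → ℝ, charPoly q = (X - C 1) ^ (n - 1) * (X - C r) := by
  apply exists_charPoly_eq
  · exact ((monic_X_sub_C 1).pow _).mul (monic_X_sub_C r)
  · rw [Monic.natDegree_mul ((monic_X_sub_C 1).pow _) (monic_X_sub_C r),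
      natDegree_pow, natDegree_X_sub_C, natDegree_X_sub_C]
    omega

theorem isCoprime_C {c : ℝ} (hc : c ≠ 0) (P : ℝ[X]) : IsCoprime P (C c) :=
  ⟨0, C c⁻¹, by rw [zero_mul, zero_add, ← C_mul, inv_mul_cancel₀ hc, C_1]⟩

/-- For `U = (x - 1) ^ (n - 1) (x - r)` and `S = s (x - 1) ^ (n - 1)` the value `F(1)` depends on
`s`. The difference of two such identities does not contain `Ψ` and can be divided by
`(x - 1) ^ (n - 1)`. -/
theorem eval_one_ne_of_test {q : Fin n → ℝ} (hn : 2 ≤ n) {r : ℝ} (h1 : r ≠ 1)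
    (hU : charPoly q = (X - C 1) ^ (n - 1) * (X - C r)) {κ : ℝ} (hκ : κ ≠ 0) {e : ℕ}
    {Ψ : ℝ[X]} {H F : ℕ → ℝ[X]} (hHd : ∀ s, (H s).degree < n)
    (h : ∀ s : ℕ, C κ * (C (1 / 2) * (C (s : ℝ) * (X - C 1) ^ (n - 1)) ^ 2 + Ψ) =
      C κ * X ^ e * H s - charPoly q * F s) : (F 1).eval 1 ≠ (F 2).eval 1 := by
  intro hF
  have hy : ((X - C 1 : ℝ[X]) ^ (n - 1)).Monic := (monic_X_sub_C 1).pow _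
  have a1 := h 1
  have a2 := h 2
  have e1 : C κ * C (3 / 2) * (X - C 1) ^ (n - 1) * (X - C 1) ^ (n - 1) =
      C κ * X ^ e * (H 2 - H 1) - (X - C 1) ^ (n - 1) * (X - C r) * (F 2 - F 1) := by
    rw [hU] at a1 a2
    have hc : (C (3 / 2) : ℝ[X]) = C (1 / 2) * C ((2 : ℕ) : ℝ) ^ 2 -
        C (1 / 2) * C ((1 : ℕ) : ℝ) ^ 2 := by
      rw [← C_pow, ← C_pow, ← C_mul, ← C_mul, ← C_sub]; norm_num
    rw [hc]
    linear_combination a2 - a1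
  have e2 : (X - C 1 : ℝ[X]) ^ (n - 1) ∣ C κ * X ^ e * (H 2 - H 1) := by
    exact ⟨C κ * C (3 / 2) * (X - C 1) ^ (n - 1) + (X - C r) * (F 2 - F 1),
      by linear_combination -e1⟩
  have cop : IsCoprime ((X - C 1 : ℝ[X]) ^ (n - 1)) (C κ * X ^ e) := by
    refine IsCoprime.pow_left (IsCoprime.mul_right ?_ (IsCoprime.pow_right ?_))
    · exact isCoprime_C hκ _
    · exact ⟨-1, 1, by rw [C_1]; ring⟩
  obtain ⟨g, hg⟩ := cop.dvd_of_dvd_mul_left e2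
  have hgd : g.degree < 1 := by
    have h3 : (H 2 - H 1).degree < n := lt_of_le_of_lt (degree_sub_le _ _) (max_lt (hHd 2) (hHd 1))
    by_cases hg0 : g = 0
    · rw [hg0, degree_zero]; exact WithBot.bot_lt_coe 1
    rw [hg] at h3
    have h4 : ((X - C 1 : ℝ[X]) ^ (n - 1) * g) ≠ 0 := mul_ne_zero hy.ne_zero hg0
    rw [← natDegree_lt_iff_degree_lt h4, natDegree_mul hy.ne_zero hg0, natDegree_pow,
      natDegree_X_sub_C] at h3
    rw [degree_eq_natDegree hg0]
    norm_cast
    omega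
  obtain ⟨c, rfl⟩ : ∃ c, g = C c :=
    ⟨g.coeff 0, eq_C_of_degree_le_zero (by
      by_cases hg0 : g = 0
      · simp [hg0]
      · rw [degree_eq_natDegree hg0] at hgd ⊢
        norm_cast at hgd ⊢
        omega)⟩
  have e3 : C κ * C (3 / 2) * (X - C 1) ^ (n - 1) = C κ * X ^ e * C c - (X - C r) * (F 2 - F 1) := by
    apply hy.ne_zero |> mul_left_cancel₀
    rw [hg] at e1
    linear_combination e1
  have e4 := congrArg (eval 1) e3
  have hn1 : n - 1 ≠ 0 := by omega
  simp [hF, hn1, hκ] at e4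
  have e5 := congrArg (eval r) e3
  simp [e4, hκ, sub_eq_zero, h1] at e5

theorem isCoprime_test {S F : ℝ[X]} {s : ℝ} (hs : s ≠ 0) {m : ℕ} (hS : S = C s * (X - C 1) ^ m)
    (hF : F.eval 1 ≠ 0) : IsCoprime S F := by
  rw [hS]
  refine IsCoprime.mul_left ?_ (IsCoprime.pow_left ?_)
  · exact (isCoprime_C hs _).symm
  · exact (irreducible_X_sub_C (1 : ℝ)).coprime_iff_not_dvd.2 (by rwa [dvd_iff_isRoot])

/-! ### The separation relation of the Benenti Hamiltonians -/

theorem horner_coeff (q : Fin n → ℝ) (j k : ℕ) :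
    (horner q j).coeff k = if k ≤ j then qc q (j - k) else 0 := by
  induction j generalizing k with
  | zero =>
    rw [horner, coeff_one]
    by_cases h : k = 0
    · subst h; simp [qc]
    · simp [h]
  | succ j ih =>
    rw [horner]
    cases k with
    | zero => simp
    | succ k =>
      rw [coeff_add, coeff_X_mul, ih, coeff_C, if_neg (Nat.succ_ne_zero k), add_zero]
      simp

theorem tensorL_apply_mulVec {m : ℕ} (q v : Fin (m + 1) → ℝ) (a : Fin (m + 1)) :
    (tensorL (m + 1) q).mulVec v a = -q a * v 0 + if h : (a : ℕ) < m then v (Fin.succ ⟨a, h⟩) else 0 := by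
  rw [Matrix.mulVec, dotProduct, Fin.sum_univ_succ]
  congr 1
  simp only [tensorL, Matrix.of_apply, Fin.val_succ, Nat.succ_ne_zero, if_false, add_left_inj,
    ite_mul, one_mul, zero_mul]
  split_ifs with h
  · rw [Finset.sum_eq_single ⟨a, h⟩]
    · simp
    · intro b _ hb; rw [if_neg]; intro h'; apply hb; ext; exact h'
    · simp
  · refine Finset.sum_eq_zero fun b _ => if_neg ?_
    have := b.2; omega

/-- The matrix `L` represents multiplication by `X` modulo its characteristic polynomial. -/
theorem X_mul_vecPoly (q v : Fin n → ℝ) :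
    charPoly q ∣ X * vecPoly v - vecPoly ((tensorL n q).mulVec v) := by
  cases n with
  | zero => simp [vecPoly]
  | succ m =>
    refine ⟨C (v 0), ?_⟩
    have h1 : vecPoly ((tensorL (m + 1) q).mulVec v) = -C (v 0) * vecPoly q +
        ∑ a : Fin m, C (v a.succ) * X ^ (m - (a : ℕ)) := by
      have h2 : (tensorL (m + 1) q).mulVec v = (-v 0) • q +
          fun a : Fin (m + 1) => if h : (a : ℕ) < m then v (Fin.succ ⟨a, h⟩) else 0 := by
        ext a; rw [tensorL_apply_mulVec]; simp [mul_comm]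
      rw [h2, vecPoly_add, vecPoly_smul, C_neg]
      congr 1
      rw [vecPoly, Fin.sum_univ_castSucc]
      simp
    rw [h1, charPoly_eq, vecPoly, Fin.sum_univ_succ, mul_add, Finset.mul_sum]
    have h3 : ∀ a : Fin m, X * (C (v a.succ) * X ^ (m + 1 - 1 - ((a.succ : Fin (m + 1)) : ℕ))) =
        C (v a.succ) * X ^ (m - (a : ℕ)) := fun a => by
      have := a.2
      rw [Fin.val_succ, show m - (a : ℕ) = (m + 1 - 1 - (a + 1)) + 1 by omega, pow_succ]; ring
    rw [Finset.sum_congr rfl fun a _ => h3 a]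
    simp only [Fin.val_zero, Nat.add_sub_cancel, Nat.sub_zero]
    ring

theorem aeval_mulVec_vecPoly (q : Fin n → ℝ) (g : ℝ[X]) (v : Fin n → ℝ) :
    charPoly q ∣ g * vecPoly v - vecPoly ((aeval (tensorL n q) g).mulVec v) := by
  induction g using Polynomial.induction_on generalizing v with
  | C a =>
    rw [aeval_C, Algebra.algebraMap_eq_smul_one, Matrix.smul_mulVec, Matrix.one_mulVec,
      vecPoly_smul, sub_self]
    exact dvd_zero _
  | add g h hg hh =>
    rw [map_add, Matrix.add_mulVec, vecPoly_add]
    have := dvd_add (hg v) (hh v)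
    rwa [show g * vecPoly v - vecPoly ((aeval (tensorL n q) g).mulVec v) +
      (h * vecPoly v - vecPoly ((aeval (tensorL n q) h).mulVec v)) = (g + h) * vecPoly v -
      (vecPoly ((aeval (tensorL n q) g).mulVec v) + vecPoly ((aeval (tensorL n q) h).mulVec v))
      by ring] at this
  | monomial k a ih =>
    have h1 := ih ((tensorL n q).mulVec v)
    have h2 : (aeval (tensorL n q) (C a * X ^ (k + 1))).mulVec v =
        (aeval (tensorL n q) (C a * X ^ k)).mulVec ((tensorL n q).mulVec v) := by
      rw [Matrix.mulVec_mulVec, pow_succ, ← mul_assoc, map_mul _ _ X, aeval_X]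
    rw [h2]
    have h3 := dvd_mul_of_dvd_right (X_mul_vecPoly q v) (C a * X ^ k)
    have := dvd_add h3 h1
    rwa [show C a * X ^ k * (X * vecPoly v - vecPoly ((tensorL n q).mulVec v)) +
      (C a * X ^ k * vecPoly ((tensorL n q).mulVec v) -
      vecPoly ((aeval (tensorL n q) (C a * X ^ k)).mulVec ((tensorL n q).mulVec v))) =
      C a * X ^ (k + 1) * vecPoly v -
      vecPoly ((aeval (tensorL n q) (C a * X ^ k)).mulVec ((tensorL n q).mulVec v)) by ring] at this

theorem killingK_succ (q : Fin n → ℝ) (j : ℕ) :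
    killingK n (j + 1) q = aeval (tensorL n q) (horner q j) := by
  rw [killingK, horner_eq_add, hornerDeriv_eq_sum, Finset.sum_range_succ', map_add, map_sum,
    add_comm]
  congr 1
  · simp [qc]
  · refine Finset.sum_congr rfl fun b _ => ?_
    rw [map_mul, aeval_C, map_pow, aeval_X, Algebra.smul_def,
      show j + 1 - 1 - (b + 1) = j - 1 - b by omega]

/-- The row vectors `e₀ h_j(L)`, and hence the rows `e₀ K_r`, form the standard basis. -/
theorem single_zero_vecMul_horner {m : ℕ} (q : Fin (m + 1) → ℝ) (j : Fin (m + 1)) :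
    Matrix.vecMul (Pi.single 0 1) (aeval (tensorL (m + 1) q) (horner q j)) = Pi.single j 1 := by
  obtain ⟨j, hj⟩ := j
  induction j with
  | zero => simp [horner]
  | succ j ih =>
    simp only [horner]
    rw [mul_comm, map_add, map_mul, aeval_X, aeval_C, Matrix.vecMul_add, ← Matrix.vecMul_vecMul,
      ih (by omega), Algebra.algebraMap_eq_smul_one, Matrix.vecMul_smul, Matrix.vecMul_one]
    ext b
    rw [Pi.add_apply, Matrix.single_one_vecMul]
    have h0 : qc q (j + 1) = q ⟨j, by omega⟩ := by simp [qc, show j < m + 1 by omega]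
    simp only [Matrix.row_apply, tensorL, Matrix.of_apply, h0, Pi.smul_apply, smul_eq_mul,
      Pi.single_apply, Fin.ext_iff, Fin.val_zero]
    by_cases hb : (b : ℕ) = 0
    · simp [hb]
    · simp [hb]

/-- The entry `(l, m)` of `K_{a+1} g(L) M` is an entry of index `a` of a vector. This exchange of `a` and
`l` turns the family of matrices `K_r` into multiplication by polynomials. -/
theorem killing_mul_apply (q : Fin n → ℝ) (l a : Fin n) (M : Matrix (Fin n) (Fin n) ℝ)
    (g : ℝ[X]) (m : Fin n) :
    (aeval (tensorL n q) (horner q a) * aeval (tensorL n q) g * M) l m =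
      (aeval (tensorL n q) (horner q l * g)).mulVec (fun b => M b m) a := by
  cases n with
  | zero => exact l.elim0
  | succ k =>
    have row : ∀ (b : Fin (k + 1)) (N : Matrix (Fin (k + 1)) (Fin (k + 1)) ℝ) (c : Fin (k + 1)),
        N b c = (aeval (tensorL (k + 1) q) (horner q b) * N) 0 c := by
      intro b N c
      have h1 : N b c = Matrix.vecMul (Pi.single b 1) N c := by
        rw [Matrix.single_one_vecMul]; rfl
      rw [h1, ← single_zero_vecMul_horner q b, Matrix.vecMul_vecMul, Matrix.single_one_vecMul]
      rfl
    have h2 : (aeval (tensorL (k + 1) q) (horner q l * g)).mulVec (fun b => M b m) a =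
        (aeval (tensorL (k + 1) q) (horner q l * g) * M) a m := rfl
    have h3 : aeval (tensorL (k + 1) q) (horner q l) *
        (aeval (tensorL (k + 1) q) (horner q a) * aeval (tensorL (k + 1) q) g * M) =
        aeval (tensorL (k + 1) q) (horner q a) *
          (aeval (tensorL (k + 1) q) (horner q l * g) * M) := by
      simp only [← mul_assoc, ← map_mul]
      congr 2
      ring
    rw [h2]
    refine (row l _ m).trans (Eq.trans ?_ (row a _ m).symm)
    rw [h3]

theorem vecPoly_metricG (q : Fin n → ℝ) (m : Fin n) :
    vecPoly (fun a => metricG n q a m) = horner q m := by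
  ext k
  by_cases hk : k < n
  · have := vecPoly_coeff (n := n) (fun a => metricG n q a m) ⟨n - 1 - k, by omega⟩
    simp only at this
    rw [show n - 1 - (n - 1 - k) = k by omega] at this
    rw [this, horner_coeff, metricG, Matrix.of_apply]
    have hm := m.2
    by_cases h : k ≤ m
    · rw [if_pos h, if_pos (by simp only; omega)]
      congr 1; simp only; omega
    · rw [if_neg h, if_neg (by simp only; omega)]
  · rw [(degree_lt_iff_coeff_zero _ _).1 (vecPoly_degree_lt _) k (by omega),
      (degree_lt_iff_coeff_zero _ _).1 (horner_degree_lt q m) k (by omega)]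

theorem dvd_sum_sub_sum {ι : Type*} {s : Finset ι} {A : ℝ[X]} {f g : ι → ℝ[X]}
    (h : ∀ i ∈ s, A ∣ f i - g i) : A ∣ ∑ i ∈ s, f i - ∑ i ∈ s, g i := by
  rw [← Finset.sum_sub_distrib]; exact Finset.dvd_sum h

/-- The kinetic energies satisfy `∑ E_{i,r} x ^ (n - r) ≡ ½ x ^ i W²`. -/
theorem separation_geodesicE (i : ℕ) (z : PhaseSpace n) :
    charPoly z.1 ∣ vecPoly (fun a : Fin n => geodesicE n i ((a : ℕ) + 1) z) -
      C (1 / 2) * X ^ i * momentumPoly z ^ 2 := by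
  have h1 : (fun a : Fin n => geodesicE n i ((a : ℕ) + 1) z) = (1 / 2 : ℝ) • ∑ l : Fin n,
      ∑ m : Fin n, (z.2 l * z.2 m) •
        (aeval (tensorL n z.1) (horner z.1 l * X ^ i)).mulVec (fun b => metricG n z.1 b m) := by
    ext a
    simp only [Pi.smul_apply, Finset.sum_apply, smul_eq_mul, geodesicE]
    congr 1
    refine Finset.sum_congr rfl fun l _ => Finset.sum_congr rfl fun m _ => ?_
    rw [← killing_mul_apply, killingK_succ, map_pow, aeval_X]; ring
  have h2 : C (1 / 2) * X ^ i * momentumPoly z ^ 2 = C (1 / 2) * ∑ l : Fin n, ∑ m : Fin n,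
      C (z.2 l * z.2 m) * (horner z.1 l * X ^ i * vecPoly (fun b => metricG n z.1 b m)) := by
    rw [momentumPoly, neg_sq, sq, Finset.sum_mul_sum, mul_assoc, Finset.mul_sum]
    congr 1
    refine Finset.sum_congr rfl fun l _ => ?_
    rw [Finset.mul_sum]
    refine Finset.sum_congr rfl fun m _ => ?_
    rw [vecPoly_metricG, C_mul]; ring
  rw [h1, h2, vecPoly_smul, vecPoly_sum, ← mul_sub]
  refine dvd_mul_of_dvd_right (dvd_sum_sub_sum fun l _ => ?_) _
  rw [vecPoly_sum]
  refine dvd_sum_sub_sum fun m _ => ?_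
  rw [vecPoly_smul, ← mul_sub, ← neg_sub]
  exact dvd_mul_of_dvd_right ((dvd_neg).2 (aeval_mulVec_vecPoly z.1 _ _)) _

theorem posPotential_succ_eq_mulVec (q : Fin n → ℝ) (m : ℕ) :
    (fun a : Fin n => posPotential n q (m + 1) ((a : ℕ) + 1)) =
      (tensorL n q).mulVec fun a => posPotential n q m ((a : ℕ) + 1) := by
  cases n with
  | zero => exact Subsingleton.elim _ _
  | succ k =>
    ext a
    rw [tensorL_apply_mulVec]
    have ha := a.2
    rw [posPotential, if_pos ⟨by omega, by omega⟩, qc_succ, add_comm]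
    congr 1
    split_ifs with h
    · rfl
    · have : ∀ m, posPotential (k + 1) q m ((a : ℕ) + 1 + 1) = 0 := by
        intro m; cases m <;> simp [posPotential, h]
      exact this m

theorem separation_posPotential (q : Fin n → ℝ) (m : ℕ) :
    charPoly q ∣ vecPoly (fun a : Fin n => posPotential n q m ((a : ℕ) + 1)) - X ^ (n + m) := by
  induction m with
  | zero =>
    have : (fun a : Fin n => posPotential n q 0 ((a : ℕ) + 1)) = (-1 : ℝ) • q := by
      ext a
      have ha := a.2
      rw [posPotential, if_pos ⟨by omega, by omega⟩, qc_succ]; simp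
    rw [this, vecPoly_smul, charPoly_eq]
    exact ⟨-1, by simp; ring⟩
  | succ m ih =>
    rw [posPotential_succ_eq_mulVec]
    obtain ⟨A, hA⟩ := ih
    obtain ⟨B, hB⟩ := X_mul_vecPoly q fun a : Fin n => posPotential n q m ((a : ℕ) + 1)
    exact ⟨X * A - B, by rw [← add_assoc, pow_succ]; linear_combination X * hA - hB⟩

/-- One step of the recursion for the negative potentials, read as a division by `x` modulo
`charPoly`: the vector `w_a - (q^a / qⁿ) c` is `v` shifted by one place, corrected by a multiple
of the polynomial `(U - qⁿ) / x`. -/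
theorem X_mul_vecPoly_shift {k : ℕ} (q : Fin (k + 1) → ℝ) (hq : qc q (k + 1) ≠ 0)
    (v : Fin (k + 1) → ℝ) (w : ℕ → ℝ) (hw : w 0 = 0) (hwv : ∀ a : Fin (k + 1), w (a + 1) = v a)
    (c : ℝ) :
    charPoly q ∣ X * vecPoly (fun a : Fin (k + 1) => w a + -(qc q a / qc q (k + 1)) * c) -
      (vecPoly v + C (c - v (Fin.last k))) := by
  have h1 : X * vecPoly (fun a : Fin (k + 1) => w a) = vecPoly v - C (v (Fin.last k)) := by
    rw [vecPoly, vecPoly, Fin.sum_univ_succ, Fin.sum_univ_castSucc, mul_add, Finset.mul_sum]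
    have h3 : ∀ a : Fin k, X * (C (w (a.succ : Fin (k + 1))) *
        X ^ (k + 1 - 1 - ((a.succ : Fin (k + 1)) : ℕ))) =
        C (v a.castSucc) * X ^ (k + 1 - 1 - ((a.castSucc : Fin (k + 1)) : ℕ)) := fun a => by
      have := a.2
      rw [← hwv, Fin.val_castSucc, Fin.val_succ,
        show k + 1 - 1 - (a : ℕ) = (k + 1 - 1 - (a + 1)) + 1 by omega, pow_succ]
      ring
    rw [Finset.sum_congr rfl fun a _ => h3 a]
    simp [hw]
  have h2 : X * vecPoly (fun a : Fin (k + 1) => qc q a) = charPoly q - C (qc q (k + 1)) := by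
    have : vecPoly (fun a : Fin (k + 1) => qc q a) = horner q k := by
      rw [horner_eq_add, hornerDeriv_eq_sum, vecPoly, Fin.sum_univ_succ, Finset.sum_range]
      congr 1
      · simp [qc]
      · refine Finset.sum_congr rfl fun b _ => ?_
        rw [Fin.val_succ]; congr 2; omega
    rw [this, charPoly, horner]; ring
  have h4 : (fun a : Fin (k + 1) => w a + -(qc q a / qc q (k + 1)) * c) =
      (fun a : Fin (k + 1) => w a) + (-(c / qc q (k + 1))) • fun a : Fin (k + 1) => qc q a := by
    ext a; simp; ring
  refine ⟨-C (c / qc q (k + 1)), ?_⟩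
  have h5 : (C (c / qc q (k + 1)) : ℝ[X]) * C (qc q (k + 1)) = C c := by
    rw [← C_mul, div_mul_cancel₀ _ hq]
  rw [h4, vecPoly_add, vecPoly_smul, C_neg, C_sub]
  linear_combination h1 - C (c / qc q (k + 1)) * h2 + h5

theorem separation_negPotential {q : Fin n → ℝ} (hq : qc q n ≠ 0) (m : ℕ) :
    charPoly q ∣ X ^ (m + 1) * vecPoly (fun a : Fin n => negPotential n q m ((a : ℕ) + 1)) - 1 := by
  cases n with
  | zero => simp [charPoly, horner]
  | succ k =>
    induction m with
    | zero =>
      have h := X_mul_vecPoly_shift q hq 0 (fun _ => 0) rfl (fun _ => rfl) 1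
      have h1 : (fun a : Fin (k + 1) => negPotential (k + 1) q 0 ((a : ℕ) + 1)) =
          fun a : Fin (k + 1) => 0 + -(qc q a / qc q (k + 1)) * 1 := by
        ext a
        have ha := a.2
        rw [negPotential, if_pos ⟨by omega, by omega⟩]; simp
      rw [h1]
      simpa [vecPoly_zero] using h
    | succ m ih =>
      have h := X_mul_vecPoly_shift q hq (fun a => negPotential (k + 1) q m ((a : ℕ) + 1))
        (fun a => negPotential (k + 1) q m a) (by cases m <;> simp [negPotential]) (fun _ => rfl)
        (negPotential (k + 1) q m (k + 1))
      have h1 : (fun a : Fin (k + 1) => negPotential (k + 1) q (m + 1) ((a : ℕ) + 1)) =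
          fun a : Fin (k + 1) => negPotential (k + 1) q m a +
            -(qc q a / qc q (k + 1)) * negPotential (k + 1) q m (k + 1) := by
        ext a
        have ha := a.2
        rw [negPotential, if_pos ⟨by omega, by omega⟩, Nat.add_sub_cancel]
      rw [h1]
      simp only [Fin.val_last, sub_self, C_0, add_zero] at h
      obtain ⟨A, hA⟩ := ih
      obtain ⟨B, hB⟩ := h
      exact ⟨A + X ^ (m + 1) * B, by
        rw [pow_succ X (m + 1)]; linear_combination hA + X ^ (m + 1) * hB⟩

/-- The polynomial `Ψ` with `x ^ e V^{(k)} ≡ Ψ`: it is `x ^ (e + n - 1 + k)` for `k > 0` and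
`x ^ (e + k)` for `k < 0`. For `k = 0` it vanishes, as the potential does. The truncation
`Int.toNat` is harmless for `-e ≤ k`. -/
def potentialSource (n e : ℕ) (k : ℤ) : ℝ[X] :=
  if k = 0 then 0 else if 0 < k then X ^ ((e : ℤ) + n - 1 + k).toNat else X ^ ((e : ℤ) + k).toNat

theorem natDegree_potentialSource_le {e : ℕ} {k : ℤ} (he : e + 1 ≤ n) (hk : k ≤ (n : ℤ) - 1 - e) :
    (potentialSource n e k).natDegree ≤ 2 * n - 2 := by
  unfold potentialSource
  split_ifs with h0 h1
  · simp
  · rw [natDegree_X_pow]; omega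
  · rw [natDegree_X_pow]; omega

theorem separation_potentialV {q : Fin n → ℝ} (hq : qc q n ≠ 0) {e : ℕ} {k : ℤ} (hk : -(e : ℤ) ≤ k) :
    charPoly q ∣ X ^ e * vecPoly (fun a : Fin n => potentialV n q k ((a : ℕ) + 1)) -
      potentialSource n e k := by
  match k, hk with
  | Int.ofNat 0, _ => simp [potentialSource, potentialV, ← Pi.zero_def, vecPoly_zero]
  | Int.ofNat (m + 1), _ =>
    have h1 : potentialSource n e (Int.ofNat (m + 1)) = X ^ e * X ^ (n + m) := by
      rw [potentialSource, if_neg (by simp; omega), if_pos (by simp), ← pow_add]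
      congr 1; simp; omega
    rw [h1, ← mul_sub]
    exact dvd_mul_of_dvd_right (separation_posPotential q m) _
  | Int.negSucc m, hk =>
    have h0 : m + 1 ≤ e := by omega
    have h1 : potentialSource n e (Int.negSucc m) = X ^ (e - (m + 1)) := by
      rw [potentialSource, if_neg (by omega), if_neg (by omega)]
      congr 1; omega
    have h2 : (X : ℝ[X]) ^ e = X ^ (e - (m + 1)) * X ^ (m + 1) := by
      rw [← pow_add]; congr 1; omega
    rw [h1, h2, mul_assoc, ← mul_sub_one]
    exact dvd_mul_of_dvd_right (separation_negPotential hq m) _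

theorem separationRelation_hamiltonianH {e i : ℕ} {k : ℤ} (hk : -(e : ℤ) ≤ k) {z : PhaseSpace n}
    (hq : qc z.1 n ≠ 0) :
    SeparationRelation e (e + i) (potentialSource n e k)
      (fun w (a : Fin n) => hamiltonianH n i ((a : ℕ) + 1) k w) z := by
  have h : (fun a : Fin n => hamiltonianH n i ((a : ℕ) + 1) k z) =
      (fun a : Fin n => geodesicE n i ((a : ℕ) + 1) z) +
        fun a : Fin n => potentialV n z.1 k ((a : ℕ) + 1) := rfl
  rw [SeparationRelation, h, vecPoly_add]
  obtain ⟨A, hA⟩ := separation_geodesicE i z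
  obtain ⟨B, hB⟩ := separation_potentialV hq hk
  exact ⟨X ^ e * A + B, by rw [pow_add]; linear_combination X ^ e * hA + hB⟩

/-! ### Analyticity and the Poisson bracket -/

section Analytic

theorem analyticAt_position (a : Fin n) (q : Fin n → ℝ) :
    AnalyticAt ℝ (fun w : Fin n → ℝ => w a) q :=
  (ContinuousLinearMap.proj (R := ℝ) (φ := fun _ : Fin n => ℝ) a).analyticAt q

theorem analyticAt_qc (j : ℕ) (q : Fin n → ℝ) : AnalyticAt ℝ (fun w : Fin n → ℝ => qc w j) q := by
  unfold qc
  split_ifs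
  · exact analyticAt_const
  · exact analyticAt_position _ q
  · exact analyticAt_const

theorem analyticAt_matrix_mul {A B : (Fin n → ℝ) → Matrix (Fin n) (Fin n) ℝ} {q : Fin n → ℝ}
    (hA : ∀ l m, AnalyticAt ℝ (fun w => A w l m) q) (hB : ∀ l m, AnalyticAt ℝ (fun w => B w l m) q)
    (l m : Fin n) : AnalyticAt ℝ (fun w => (A w * B w) l m) q := by
  simp only [Matrix.mul_apply]
  exact Finset.analyticAt_fun_sum _ fun c _ => (hA l c).mul (hB c m)

theorem analyticAt_tensorL_pow (i : ℕ) (q : Fin n → ℝ) (l m : Fin n) :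
    AnalyticAt ℝ (fun w => (tensorL n w ^ i) l m) q := by
  induction i generalizing l m with
  | zero => simpa using analyticAt_const
  | succ i ih =>
    simp only [pow_succ]
    refine analyticAt_matrix_mul ih (fun l m => ?_) l m
    simp only [tensorL, Matrix.of_apply]
    split_ifs
    · exact (analyticAt_position l q).neg
    · exact analyticAt_const
    · exact analyticAt_const

/-- The matrix of the quadratic form `2 E_{i,r}` has analytic entries. -/
theorem analyticAt_geodesic_matrix (i r : ℕ) (q : Fin n → ℝ) (l m : Fin n) :
    AnalyticAt ℝ (fun w => (killingK n r w * tensorL n w ^ i * metricG n w) l m) q := by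
  refine analyticAt_matrix_mul (analyticAt_matrix_mul (fun l m => ?_) (analyticAt_tensorL_pow i q))
    (fun l m => ?_) l m
  · simp only [killingK, Matrix.sum_apply, Matrix.smul_apply, smul_eq_mul]
    exact Finset.analyticAt_fun_sum _ fun c _ =>
      (analyticAt_qc c q).mul (analyticAt_tensorL_pow _ q l m)
  · simp only [metricG, Matrix.of_apply]
    split_ifs
    · exact analyticAt_qc _ q
    · exact analyticAt_const

theorem analyticAt_comp_fst {f : (Fin n → ℝ) → ℝ} {z : PhaseSpace n} (hf : AnalyticAt ℝ f z.1) :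
    AnalyticAt ℝ (fun w : PhaseSpace n => f w.1) z :=
  hf.comp analyticAt_fst

theorem analyticAt_momentum (a : Fin n) (z : PhaseSpace n) :
    AnalyticAt ℝ (fun w : PhaseSpace n => w.2 a) z :=
  (analyticAt_position a z.2).comp analyticAt_snd

theorem analyticAt_quadratic {A : (Fin n → ℝ) → Matrix (Fin n) (Fin n) ℝ} {z : PhaseSpace n}
    (hA : ∀ l m, AnalyticAt ℝ (fun w => A w l m) z.1) :
    AnalyticAt ℝ (fun w : PhaseSpace n => ∑ l : Fin n, ∑ m : Fin n, A w.1 l m * w.2 l * w.2 m) z :=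
  Finset.analyticAt_fun_sum _ fun l _ => Finset.analyticAt_fun_sum _ fun m _ =>
    ((analyticAt_comp_fst (hA l m)).mul (analyticAt_momentum l z)).mul (analyticAt_momentum m z)

theorem analyticAt_posPotential (m r : ℕ) (q : Fin n → ℝ) :
    AnalyticAt ℝ (fun w => posPotential n w m r) q := by
  induction m generalizing r with
  | zero =>
    simp only [posPotential]
    split_ifs
    · exact (analyticAt_qc r q).neg
    · exact analyticAt_const
  | succ m ih =>
    simp only [posPotential]
    split_ifs
    · exact (ih _).add ((analyticAt_qc r q).neg.mul (ih _))
    · exact analyticAt_const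

theorem analyticAt_negPotential (m r : ℕ) {q : Fin n → ℝ} (hq : qc q n ≠ 0) :
    AnalyticAt ℝ (fun w => negPotential n w m r) q := by
  have h : ∀ r, AnalyticAt ℝ (fun w : Fin n → ℝ => -(qc w (r - 1) / qc w n)) q := fun r =>
    ((analyticAt_qc (r - 1) q).div (analyticAt_qc n q) hq).neg
  induction m generalizing r with
  | zero =>
    simp only [negPotential]
    split_ifs
    · exact h r
    · exact analyticAt_const
  | succ m ih =>
    simp only [negPotential]
    split_ifs
    · exact (ih _).add ((h r).mul (ih _))
    · exact analyticAt_const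

theorem analyticAt_potentialV {k : ℤ} (r : ℕ) {q : Fin n → ℝ} (hq : q ∈ chart n k) :
    AnalyticAt ℝ (fun w => potentialV n w k r) q := by
  match k, hq with
  | Int.ofNat 0, _ => exact analyticAt_const
  | Int.ofNat (m + 1), _ => exact analyticAt_posPotential m r q
  | Int.negSucc m, hq => exact analyticAt_negPotential m r (hq (Int.negSucc_lt_zero m))

theorem analyticAt_hamiltonianH (i r : ℕ) {k : ℤ} {z : PhaseSpace n} (hz : z.1 ∈ chart n k) :
    AnalyticAt ℝ (hamiltonianH n i r k) z :=
  (analyticAt_const.mul (analyticAt_quadratic (analyticAt_geodesic_matrix i r z.1))).add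
    (analyticAt_comp_fst (analyticAt_potentialV r hz))

theorem isOpen_regular : IsOpen {z : PhaseSpace n | qc z.1 n ≠ 0} :=
  isOpen_ne_fun (continuous_iff_continuousAt.2 fun z =>
    (analyticAt_comp_fst (analyticAt_qc n z.1)).continuousAt) continuous_const

theorem isOpen_cotangent_chart (n : ℕ) (k : ℤ) : IsOpen (cotangent (chart n k)) := by
  by_cases hk : k < 0
  · convert isOpen_regular (n := n) using 1
    ext z; simp [cotangent, chart, hk]
  · convert isOpen_univ (X := PhaseSpace n) using 1
    ext z; simp [cotangent, chart, hk]

/-- Every potential is defined where `qⁿ ≠ 0`; for `k ≥ 0` the chart is larger. -/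
theorem regular_subset_cotangent_chart (n : ℕ) (k : ℤ) :
    {z : PhaseSpace n | qc z.1 n ≠ 0} ⊆ cotangent (chart n k) := fun _ hz _ => hz

end Analytic

section Bracket

/-- The Hamiltonian vector field, up to sign, of a differential `α`:
`{f, g} = dg (hamVec (df))`. -/
def hamVec : (PhaseSpace n →L[ℝ] ℝ) →L[ℝ] PhaseSpace n :=
  ∑ j : Fin n,
    ((ContinuousLinearMap.apply ℝ ℝ ((Pi.single j 1, 0) : PhaseSpace n)).smulRight
        ((0, Pi.single j 1) : PhaseSpace n) -
      (ContinuousLinearMap.apply ℝ ℝ ((0, Pi.single j 1) : PhaseSpace n)).smulRight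
        ((Pi.single j 1, 0) : PhaseSpace n))

theorem hamVec_apply (α : PhaseSpace n →L[ℝ] ℝ) :
    hamVec α = ∑ j : Fin n, (α (Pi.single j 1, 0) • ((0, Pi.single j 1) : PhaseSpace n) -
      α (0, Pi.single j 1) • ((Pi.single j 1, 0) : PhaseSpace n)) := by
  simp [hamVec]

theorem apply_hamVec (α β : PhaseSpace n →L[ℝ] ℝ) :
    β (hamVec α) = ∑ j : Fin n, (α (Pi.single j 1, 0) * β (0, Pi.single j 1) -
      α (0, Pi.single j 1) * β (Pi.single j 1, 0)) := by
  rw [hamVec_apply, map_sum]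
  simp only [map_sub, map_smul, smul_eq_mul]

/-- Antisymmetry of the canonical Poisson tensor. -/
theorem apply_hamVec_comm (α β : PhaseSpace n →L[ℝ] ℝ) : β (hamVec α) = -α (hamVec β) := by
  rw [apply_hamVec, apply_hamVec, ← Finset.sum_neg_distrib]
  exact Finset.sum_congr rfl fun j _ => by ring

theorem poissonBracket_eq_right (f g : PhaseSpace n → ℝ) (z : PhaseSpace n) :
    poissonBracket f g z = fderiv ℝ g z (hamVec (fderiv ℝ f z)) := (apply_hamVec _ _).symm

theorem poissonBracket_eq_left (f g : PhaseSpace n → ℝ) (z : PhaseSpace n) :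
    poissonBracket f g z = fderiv ℝ f z (-hamVec (fderiv ℝ g z)) := by
  rw [poissonBracket_eq_right, apply_hamVec_comm, map_neg]

theorem poissonBracket_comm (f g : PhaseSpace n → ℝ) (z : PhaseSpace n) :
    poissonBracket f g z = -poissonBracket g f z := by
  rw [poissonBracket_eq_left, poissonBracket_eq_right, map_neg]

theorem analyticAt_poissonBracket {f g : PhaseSpace n → ℝ} {z : PhaseSpace n}
    (hf : AnalyticAt ℝ f z) (hg : AnalyticAt ℝ g z) : AnalyticAt ℝ (poissonBracket f g) z := by
  have h : ∀ {f : PhaseSpace n → ℝ} (v : PhaseSpace n), AnalyticAt ℝ f z →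
      AnalyticAt ℝ (fun w => fderiv ℝ f w v) z := fun v hf =>
    ((ContinuousLinearMap.apply ℝ ℝ v).analyticAt _).comp hf.fderiv
  exact Finset.analyticAt_fun_sum _ fun j _ => ((h _ hf).mul (h _ hg)).sub ((h _ hf).mul (h _ hg))

theorem fderiv_poissonBracket {f g : PhaseSpace n → ℝ} {z : PhaseSpace n}
    (hf : AnalyticAt ℝ f z) (hg : AnalyticAt ℝ g z) (v : PhaseSpace n) :
    fderiv ℝ (poissonBracket f g) z v =
      fderiv ℝ (fderiv ℝ g) z v (hamVec (fderiv ℝ f z)) -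
        fderiv ℝ (fderiv ℝ f) z v (hamVec (fderiv ℝ g z)) := by
  have h0 : poissonBracket f g = fun w => fderiv ℝ g w (hamVec (fderiv ℝ f w)) :=
    funext fun w => poissonBracket_eq_right f g w
  have h1 := hf.fderiv.differentiableAt.hasFDerivAt
  have h2 := hg.fderiv.differentiableAt.hasFDerivAt
  have h3 : HasFDerivAt (fun w => fderiv ℝ g w (hamVec (fderiv ℝ f w))) _ z :=
    h2.clm_apply (hamVec.hasFDerivAt.comp z h1)
  rw [h0, h3.fderiv]
  simp only [_root_.add_apply, ContinuousLinearMap.comp_apply, ContinuousLinearMap.flip_apply]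
  rw [apply_hamVec_comm (fderiv ℝ (fderiv ℝ f) z v)]
  ring

theorem fderiv_fderiv_comm {f : PhaseSpace n → ℝ} {z : PhaseSpace n} (hf : AnalyticAt ℝ f z)
    (u v : PhaseSpace n) :
    fderiv ℝ (fderiv ℝ f) z u v = fderiv ℝ (fderiv ℝ f) z v u :=
  (hf.contDiffAt (n := 2)).isSymmSndFDerivAt (by simp) u v

theorem poissonBracket_jacobi {f g h : PhaseSpace n → ℝ} {z : PhaseSpace n}
    (hf : AnalyticAt ℝ f z) (hg : AnalyticAt ℝ g z) (hh : AnalyticAt ℝ h z) :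
    poissonBracket f (poissonBracket g h) z =
      poissonBracket (poissonBracket f g) h z + poissonBracket g (poissonBracket f h) z := by
  rw [poissonBracket_comm (poissonBracket f g) h, poissonBracket_eq_right f,
    poissonBracket_eq_right g, poissonBracket_eq_right h, fderiv_poissonBracket hg hh,
    fderiv_poissonBracket hf hg, fderiv_poissonBracket hf hh,
    fderiv_fderiv_comm hf (hamVec (fderiv ℝ h z)), fderiv_fderiv_comm hg (hamVec (fderiv ℝ h z)),
    fderiv_fderiv_comm hh (hamVec (fderiv ℝ g z))]
  ring

theorem poissonBracket_eq_zero_of_eventuallyEq {f g : PhaseSpace n → ℝ} {z : PhaseSpace n}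
    (hg : ∀ᶠ w in 𝓝 z, g w = 0) : poissonBracket f g z = 0 := by
  have : g =ᶠ[𝓝 z] fun _ => 0 := hg
  rw [poissonBracket_eq_right, this.fderiv_eq]
  simp

/-- The bracket of two integrals of motion of `f` is an integral of motion of `f`. -/
theorem poissonBracket_poissonBracket_eq_zero {f g h : PhaseSpace n → ℝ} {z : PhaseSpace n}
    (hf : AnalyticAt ℝ f z) (hg : AnalyticAt ℝ g z) (hh : AnalyticAt ℝ h z)
    (hfg : ∀ᶠ w in 𝓝 z, poissonBracket f g w = 0) (hfh : ∀ᶠ w in 𝓝 z, poissonBracket f h w = 0) :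
    poissonBracket f (poissonBracket g h) z = 0 := by
  rw [poissonBracket_jacobi hf hg hh, poissonBracket_comm (poissonBracket f g),
    poissonBracket_eq_zero_of_eventuallyEq hfg, poissonBracket_eq_zero_of_eventuallyEq hfh]
  simp

end Bracket

/-! ### Linear functions of the momenta generating the quadratic integrals -/

theorem momentumDeriv_add (z u v : PhaseSpace n) :
    momentumDeriv z (u + v) = momentumDeriv z u + momentumDeriv z v := by
  ext k
  rw [coeff_add, ← (hasPolyDerivAt_momentumPoly z (u + v) k).2,
    ← (hasPolyDerivAt_momentumPoly z u k).2, ← (hasPolyDerivAt_momentumPoly z v k).2, map_add]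

theorem momentumDeriv_smul (z : PhaseSpace n) (c : ℝ) (v : PhaseSpace n) :
    momentumDeriv z (c • v) = C c * momentumDeriv z v := by
  ext k
  rw [coeff_C_mul, ← (hasPolyDerivAt_momentumPoly z (c • v) k).2,
    ← (hasPolyDerivAt_momentumPoly z v k).2, map_smul, smul_eq_mul]

theorem momentumDeriv_degree_lt (z v : PhaseSpace n) : (momentumDeriv z v).degree < n := by
  rw [degree_lt_iff_coeff_zero]
  intro k hk
  rw [← (hasPolyDerivAt_momentumPoly z v k).2]
  have : (fun w : PhaseSpace n => (momentumPoly w).coeff k) = fun _ => 0 :=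
    funext fun w => (degree_lt_iff_coeff_zero _ _).1 (momentumPoly_degree_lt w) k hk
  simp [this]

/-- A function `J`, linear in the momenta, whose flow `X_J` (normalised by `{f, J} = df(X_J)`)
moves `U` by `κ x ^ e` and satisfies `x ^ (f - e) X_J W ≡ κ T` modulo `U`, where `T` is the quotient of
`x ^ f W` by `U`. The matrix `β` gives the momentum component of the flow. These are
the properties of `J` common to the translations and the scaling-type symmetries. -/
structure MomentumSymmetry (n i e : ℕ) (J : PhaseSpace n → ℝ) where
  f : ℕ
  κ : (Fin n → ℝ) → ℝ
  T : PhaseSpace n → ℝ[X]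
  β : (Fin n → ℝ) → Matrix (Fin n) (Fin n) ℝ
  he : e + 1 ≤ n
  hef : e ≤ f
  two_mul_f : 2 * f = e + i
  κ_eq : (∀ q, κ q = 1) ∨ ∀ q, κ q = qc q n
  analyticAt : ∀ z, AnalyticAt ℝ J z
  flow_eq : ∀ z, -hamVec (fderiv ℝ J z) =
    (κ z.1 • Pi.single ⟨n - 1 - e, by omega⟩ 1, (β z.1).mulVec z.2)
  flow_dvd : ∀ z, charPoly z.1 ∣
    X ^ (f - e) * momentumDeriv z (-hamVec (fderiv ℝ J z)) - C (κ z.1) * T z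
  degree_lt : ∀ z, (X ^ f * momentumPoly z - charPoly z.1 * T z).degree < (n : WithBot ℕ)

/-- The flow of a momentum is the translation of the conjugate coordinate. -/
theorem flow_momentum (j : Fin n) (z : PhaseSpace n) :
    -hamVec (fderiv ℝ (fun w : PhaseSpace n => w.2 j) z) = (Pi.single j 1, 0) := by
  rw [hamVec_apply, (hasFDerivAt_momentum j z).fderiv]
  simp only [ContinuousLinearMap.comp_apply, ContinuousLinearMap.coe_snd',
    ContinuousLinearMap.proj_apply, Pi.zero_apply, zero_smul, zero_sub]
  rw [Finset.sum_eq_single j]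
  · simp
  · intro b _ hb; simp [Pi.single_eq_of_ne hb.symm]
  · simp

theorem flow_position (j : Fin n) (z : PhaseSpace n) :
    -hamVec (fderiv ℝ (fun w : PhaseSpace n => w.1 j) z) = (0, -Pi.single j 1) := by
  rw [hamVec_apply, (hasFDerivAt_position j z).fderiv]
  simp only [ContinuousLinearMap.comp_apply, ContinuousLinearMap.coe_fst',
    ContinuousLinearMap.proj_apply, Pi.zero_apply, zero_smul, sub_zero]
  rw [Finset.sum_eq_single j]
  · simp
  · intro b _ hb; simp [Pi.single_eq_of_ne hb.symm]
  · simp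

theorem nonempty_momentumSymmetry_translation {i : ℕ} (hn : 2 ≤ n) (hi : i ≤ n - 1) :
    Nonempty (MomentumSymmetry n i i (fun z => pc z.2 (n - i))) := by
  have hJ : (fun z : PhaseSpace n => pc z.2 (n - i)) = fun z => z.2 ⟨n - 1 - i, by omega⟩ := by
    funext z
    rw [pc, if_neg (by omega), dif_pos (by omega)]
    exact congrArg z.2 (Fin.ext (by simp only; omega))
  rw [hJ]
  exact ⟨
  { f := i
    κ := fun _ => 1
    T := fun z => -∑ a : Fin n, if n - i ≤ (a : ℕ) then C (z.2 a) * X ^ ((a : ℕ) - (n - i)) else 0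
    β := fun _ => 0
    he := show i + 1 ≤ n by omega
    hef := le_rfl
    two_mul_f := by omega
    κ_eq := Or.inl fun _ => rfl
    analyticAt := analyticAt_momentum _
    flow_eq := fun z => by rw [flow_momentum]; simp
    flow_dvd := fun z => by
      rw [flow_momentum, momentumDeriv_position]
      convert dvd_zero _ using 1
      rw [Nat.sub_self, pow_zero, one_mul, C_1, one_mul, sub_eq_zero]
      congr 1
      refine Finset.sum_congr rfl fun a _ => ?_
      simp only
      by_cases h : n - i ≤ (a : ℕ)
      · rw [if_pos h, if_pos (by omega)]; congr 2; omega
      · rw [if_neg h, if_neg (by omega), mul_zero]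
    degree_lt := fun z => by
      have := momentumPoly_div z (j := n - i) (by omega)
      rwa [show n - (n - i) = i by omega] at this }⟩

/-- The case `J = qⁿ p_{n-i+2}`. Here `x W'` differs from `κ T` by the multiple `p_{n-i+2} U` of `U`,
which comes from the motion of `p_n`. -/
theorem nonempty_momentumSymmetry_scaling {i : ℕ} (hn : 2 ≤ n) (hi : i = n ∨ i = n + 1) :
    Nonempty (MomentumSymmetry n i (i - 2) (fun z => qc z.1 n * pc z.2 (n + 2 - i))) := by
  have hj : n + 1 - i < n := by omega
  have hl : n - 1 < n := by omega
  have hqc : ∀ q : Fin n → ℝ, qc q n = q ⟨n - 1, hl⟩ := fun q => by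
    rw [qc, if_neg (by omega), dif_pos hl]
  have hJ : (fun z : PhaseSpace n => qc z.1 n * pc z.2 (n + 2 - i)) =
      fun z => z.1 ⟨n - 1, hl⟩ * z.2 ⟨n + 1 - i, hj⟩ := by
    funext z
    rw [hqc, pc, if_neg (by omega), dif_pos (by omega)]
    exact congrArg (fun x => z.1 ⟨n - 1, hl⟩ * z.2 x) (Fin.ext (by simp only; omega))
  rw [hJ]
  have hflow : ∀ z : PhaseSpace n,
      -hamVec (fderiv ℝ (fun z : PhaseSpace n => z.1 ⟨n - 1, hl⟩ * z.2 ⟨n + 1 - i, hj⟩) z) =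
      z.1 ⟨n - 1, hl⟩ • ((Pi.single ⟨n + 1 - i, hj⟩ 1, 0) : PhaseSpace n) +
        (-z.2 ⟨n + 1 - i, hj⟩) • ((0, Pi.single ⟨n - 1, hl⟩ 1) : PhaseSpace n) := by
    intro z
    rw [fderiv_fun_mul (hasFDerivAt_position _ z).differentiableAt
      (hasFDerivAt_momentum _ z).differentiableAt, map_add, map_smul, map_smul, neg_add,
      ← smul_neg, ← smul_neg, flow_momentum, flow_position]
    simp
  exact ⟨
  { f := i - 1
    κ := fun q => qc q n
    T := fun z => -∑ a : Fin n,
      if n + 1 - i ≤ (a : ℕ) then C (z.2 a) * X ^ ((a : ℕ) - (n + 1 - i)) else 0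
    β := fun _ => -Matrix.single ⟨n - 1, hl⟩ ⟨n + 1 - i, hj⟩ 1
    he := show i - 2 + 1 ≤ n by omega
    hef := by omega
    two_mul_f := by omega
    κ_eq := Or.inr fun _ => rfl
    analyticAt := fun z => (analyticAt_comp_fst (analyticAt_position _ z.1)).mul
      (analyticAt_momentum _ z)
    flow_eq := fun z => by
      rw [hflow, hqc]
      have h1 : (⟨n - 1 - (i - 2), by omega⟩ : Fin n) = ⟨n + 1 - i, hj⟩ := by
        ext; simp only; omega
      rw [h1]
      ext b
      · simp
      · simp [Matrix.neg_mulVec, Matrix.single_mulVec, Pi.single_apply, Function.update_apply]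
    flow_dvd := fun z => by
      rw [hflow, momentumDeriv_add, momentumDeriv_smul, momentumDeriv_smul,
        momentumDeriv_momentum, momentumDeriv_position, hqc]
      refine ⟨C (z.2 ⟨n + 1 - i, hj⟩), ?_⟩
      have h1 : X * horner z.1 (n - 1) = charPoly z.1 - C (z.1 ⟨n - 1, hl⟩) := by
        have : charPoly z.1 = X * horner z.1 (n - 1) + C (qc z.1 (n - 1 + 1)) := by
          rw [charPoly, ← horner, Nat.succ_eq_add_one, Nat.sub_add_cancel (by omega)]
        rw [this, Nat.sub_add_cancel (by omega), hqc]; ring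
      have h2 : (∑ a : Fin n, if n + 1 - i ≤ (a : ℕ) then
          C (z.2 a) * X ^ ((a : ℕ) - (n + 1 - i)) else 0 : ℝ[X]) =
          C (z.2 ⟨n + 1 - i, hj⟩) + X * ∑ a : Fin n, C (z.2 a) *
            (if n + 1 - i < (a : ℕ) then X ^ ((a : ℕ) - 1 - (n + 1 - i)) else 0) := by
        have h3 : C (z.2 ⟨n + 1 - i, hj⟩) = ∑ a : Fin n,
            if a = ⟨n + 1 - i, hj⟩ then (C (z.2 a) : ℝ[X]) else 0 := by simp
        rw [h3, Finset.mul_sum, ← Finset.sum_add_distrib]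
        refine Finset.sum_congr rfl fun a _ => ?_
        rcases lt_trichotomy (a : ℕ) (n + 1 - i) with h | h | h
        · rw [if_neg (by omega), if_neg (by rw [Fin.ext_iff]; simp only; omega), if_neg (by omega)]
          simp
        · rw [if_pos (by omega), if_pos (by rw [Fin.ext_iff]; exact h), if_neg (by omega), h]
          simp
        · rw [if_pos (by omega), if_neg (by rw [Fin.ext_iff]; simp only; omega), if_pos h,
            show (a : ℕ) - (n + 1 - i) = ((a : ℕ) - 1 - (n + 1 - i)) + 1 by omega, pow_succ]
          ring
      rw [show i - 1 - (i - 2) = 1 by omega, pow_one, h2]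
      simp only [C_neg]
      linear_combination C (z.2 ⟨n + 1 - i, hj⟩) * h1
    degree_lt := fun z => by
      have := momentumPoly_div z (j := n + 1 - i) (by omega)
      rwa [show n - (n + 1 - i) = i - 1 by omega] at this }⟩

/-! ### Integrals of motion -/

theorem poissonBracket_hamiltonianH_eq_zero_of_regular {e i : ℕ} {k : ℤ} (hk : -(e : ℤ) ≤ k)
    {z : PhaseSpace n} (hq : qc z.1 n ≠ 0) (a b : Fin n) :
    poissonBracket (hamiltonianH n i ((a : ℕ) + 1) k) (hamiltonianH n i ((b : ℕ) + 1) k) z = 0 :=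
  poissonBracket_eq_zero_of_separationRelation
    (H := fun w (a : Fin n) => hamiltonianH n i ((a : ℕ) + 1) k w) hq
    (fun _ => (analyticAt_hamiltonianH i _ (regular_subset_cotangent_chart n k hq)).differentiableAt)
    ((isOpen_regular.eventually_mem hq).mono fun _ hw => separationRelation_hamiltonianH hk hw) a b

theorem dense_regular (hn : 0 < n) : Dense {z : PhaseSpace n | qc z.1 n ≠ 0} := by
  have hl : n - 1 < n := by omega
  have h : {z : PhaseSpace n | qc z.1 n ≠ 0} =
      (fun z : PhaseSpace n => z.1 ⟨n - 1, hl⟩) ⁻¹' {0}ᶜ := by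
    ext z
    simp [qc, hn.ne', hl]
  rw [h]
  exact (dense_compl_singleton (0 : ℝ)).preimage
    ((isOpenMap_eval (X := fun _ : Fin n => ℝ) ⟨n - 1, hl⟩).comp isOpenMap_fst)

/-- Identities between continuous functions extend from `qⁿ ≠ 0` to the whole phase space. -/
theorem eq_zero_of_regular (hn : 0 < n) {g : PhaseSpace n → ℝ}
    (hg : ∀ z, qc z.1 n ≠ 0 → g z = 0) {z : PhaseSpace n} (hz : ContinuousAt g z) : g z = 0 := by
  have h1 : z ∈ closure {z : PhaseSpace n | qc z.1 n ≠ 0} := dense_regular hn z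
  have h2 : (𝓝[{z : PhaseSpace n | qc z.1 n ≠ 0}] z).NeBot := mem_closure_iff_nhdsWithin_neBot.1 h1
  have h3 : Tendsto g (𝓝[{z : PhaseSpace n | qc z.1 n ≠ 0}] z) (𝓝 (g z)) :=
    hz.tendsto.mono_left nhdsWithin_le_nhds
  refine tendsto_nhds_unique h3 (tendsto_const_nhds.congr' ?_)
  filter_upwards [self_mem_nhdsWithin] with w hw
  exact (hg w hw).symm

theorem poissonBracket_hamiltonianH_eq_zero {e i : ℕ} {k : ℤ} (hk : -(e : ℤ) ≤ k) {r s : ℕ}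
    (hr : r ∈ Finset.Icc 1 n) (hs : s ∈ Finset.Icc 1 n) {z : PhaseSpace n}
    (hz : z ∈ cotangent (chart n k)) :
    poissonBracket (hamiltonianH n i r k) (hamiltonianH n i s k) z = 0 := by
  rw [Finset.mem_Icc] at hr hs
  refine eq_zero_of_regular (by omega) (fun w hw => ?_)
    (analyticAt_poissonBracket (analyticAt_hamiltonianH i r hz)
      (analyticAt_hamiltonianH i s hz)).continuousAt
  have := poissonBracket_hamiltonianH_eq_zero_of_regular (i := i) hk hw
    ⟨r - 1, by omega⟩ ⟨s - 1, by omega⟩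
  simpa only [Nat.sub_add_cancel hr.1, Nat.sub_add_cancel hs.1] using this

namespace MomentumSymmetry

variable {i e : ℕ} {J : PhaseSpace n → ℝ} (D : MomentumSymmetry n i e J)
include D

theorem κ_ne_zero {q : Fin n → ℝ} (hq : qc q n ≠ 0) : D.κ q ≠ 0 := by
  rcases D.κ_eq with h | h <;> rw [h]
  · exact one_ne_zero
  · exact hq

theorem differentiableAt_κ (z : PhaseSpace n) :
    DifferentiableAt ℝ (fun w : PhaseSpace n => D.κ w.1) z := by
  rcases D.κ_eq with h | h <;> simp only [h]
  · exact differentiableAt_const _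
  · exact differentiableAt_qc n z

theorem fderiv_κ (z : PhaseSpace n) {v : PhaseSpace n} (hv : qc v.1 n = 0) :
    fderiv ℝ (fun w : PhaseSpace n => D.κ w.1) z v = 0 := by
  rcases D.κ_eq with h | h <;> simp only [h]
  · simp
  · obtain ⟨m, rfl⟩ : ∃ m, n = m + 1 := ⟨n - 1, by have := D.he; omega⟩
    rw [fderiv_qc_succ, hv]

/-- The remainder of `X ^ f * W` modulo the characteristic polynomial. -/
def rem (D : MomentumSymmetry n i e J) (z : PhaseSpace n) : ℝ[X] :=
  (X ^ D.f * momentumPoly z) %ₘ charPoly z.1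

theorem rem_degree_lt (z : PhaseSpace n) : (D.rem z).degree < n := by
  have := degree_modByMonic_lt (X ^ D.f * momentumPoly z) (charPoly_monic z.1)
  rwa [charPoly_degree] at this

/-- The second part is the vanishing of the coefficient of `x ^ (n - 1)` in the polynomial
`F = ∑ {H_r, J} x ^ (n - r)`, forced by the degrees in the first part. -/
theorem identity {k : ℤ} (hk : -(e : ℤ) ≤ k) (hk' : k ≤ (n : ℤ) - 1 - e) {z : PhaseSpace n}
    (hq : qc z.1 n ≠ 0) :
    C (D.κ z.1) * (C (1 / 2) * D.rem z ^ 2 + potentialSource n e k) =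
      C (D.κ z.1) * X ^ e * vecPoly (fun a : Fin n => hamiltonianH n i ((a : ℕ) + 1) k z) -
        charPoly z.1 *
          vecPoly (fun a : Fin n => poissonBracket (hamiltonianH n i ((a : ℕ) + 1) k) J z) ∧
    poissonBracket (hamiltonianH n i 1 k) J z = 0 := by
  have he := D.he
  have hn : 0 < n := by omega
  obtain ⟨Q, hQ1, hQ2⟩ := SeparationRelation.deriv
    (H := fun w (a : Fin n) => hamiltonianH n i ((a : ℕ) + 1) k w)
    (fun r => (analyticAt_hamiltonianH i _ (regular_subset_cotangent_chart n k hq)).differentiableAt)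
    ((isOpen_regular.eventually_mem hq).mono fun _ hw => separationRelation_hamiltonianH hk hw)
  have hrem : X ^ D.f * momentumPoly z = charPoly z.1 * D.T z + D.rem z := by
    have := (div_modByMonic_unique (f := X ^ D.f * momentumPoly z) (D.T z)
      (X ^ D.f * momentumPoly z - charPoly z.1 * D.T z) (charPoly_monic z.1)
      ⟨by ring, by rw [charPoly_degree]; exact D.degree_lt z⟩).2
    rw [rem, this]; ring
  have hF := hQ2 (-hamVec (fderiv ℝ J z))
  have hflow : vecPoly (-hamVec (fderiv ℝ J z)).1 = C (D.κ z.1) * X ^ e := by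
    rw [D.flow_eq z, vecPoly_smul, vecPoly_single]
    congr 2; simp only; omega
  rw [hflow, ← D.two_mul_f] at hF
  rw [← D.two_mul_f] at hQ1
  simp only [← poissonBracket_eq_left] at hF
  have := bracket_identity hn hq hrem (D.rem_degree_lt z) (vecPoly_degree_lt _)
    (vecPoly_degree_lt _) he D.hef (natDegree_potentialSource_le he hk') hQ1 hF (D.flow_dvd z)
  refine ⟨this.1, ?_⟩
  have h2 := vecPoly_coeff
    (fun a : Fin n => poissonBracket (hamiltonianH n i ((a : ℕ) + 1) k) J z) ⟨0, hn⟩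
  simp only [Nat.sub_zero, zero_add] at h2
  rw [← h2]
  exact this.2

theorem poissonBracket_hamiltonianH_one {k : ℤ} (hk : -(e : ℤ) ≤ k) (hk' : k ≤ (n : ℤ) - 1 - e)
    {z : PhaseSpace n} (hz : z ∈ cotangent (chart n k)) :
    poissonBracket (hamiltonianH n i 1 k) J z = 0 :=
  eq_zero_of_regular (by have := D.he; omega) (fun _ hw => (D.identity hk hk' hw).2)
    (analyticAt_poissonBracket (analyticAt_hamiltonianH i 1 hz) (D.analyticAt z)).continuousAt

theorem isIntegralOfMotion_poissonBracket {k : ℤ} (hk : -(e : ℤ) ≤ k) (hk' : k ≤ (n : ℤ) - 1 - e)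
    {s : ℕ} (hs : s ∈ Finset.Icc 1 n) :
    IsIntegralOfMotion (cotangent (chart n k)) (hamiltonianH n i 1 k)
      (poissonBracket (hamiltonianH n i s k) J) := by
  refine ⟨fun z hz => analyticAt_poissonBracket (analyticAt_hamiltonianH i s hz) (D.analyticAt z),
    fun z hz => ?_⟩
  have hopen := (isOpen_cotangent_chart n k).eventually_mem hz
  have h1 : 1 ∈ Finset.Icc 1 n := by rw [Finset.mem_Icc] at hs ⊢; omega
  exact poissonBracket_poissonBracket_eq_zero (analyticAt_hamiltonianH i 1 hz)
    (analyticAt_hamiltonianH i s hz) (D.analyticAt z)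
    (hopen.mono fun w hw => poissonBracket_hamiltonianH_eq_zero hk h1 hs hw)
    (hopen.mono fun w hw => D.poissonBracket_hamiltonianH_one hk hk' hw)

/-- At a point where `S` (`D.rem`) and `F` are coprime, the differentials of the integrals,
together with that of `qⁿ`, have no common kernel. -/
theorem eq_zero_of_forall_fderiv_eq_zero {k : ℤ} (hk : -(e : ℤ) ≤ k)
    (hk' : k ≤ (n : ℤ) - 1 - e) {z : PhaseSpace n} (hq : qc z.1 n ≠ 0)
    (hcop : IsCoprime (D.rem z)
      (vecPoly fun a : Fin n => poissonBracket (hamiltonianH n i ((a : ℕ) + 1) k) J z))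
    (hdeg : (D.rem z).natDegree = n - 1) (h0 : (D.rem z).coeff 0 ≠ 0) {v : PhaseSpace n}
    (hv : qc v.1 n = 0)
    (hH : ∀ a : Fin n, fderiv ℝ (hamiltonianH n i ((a : ℕ) + 1) k) z v = 0)
    (hF : ∀ b : Fin (n - 1),
      fderiv ℝ (poissonBracket (hamiltonianH n i ((b : ℕ) + 2) k) J) z v = 0) : v = 0 := by
  have he := D.he
  have hn : 0 < n := by omega
  have hz := regular_subset_cotangent_chart n k hq
  have hreg := isOpen_regular.eventually_mem hq
  have hF' : ∀ a : Fin n,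
      fderiv ℝ (poissonBracket (hamiltonianH n i ((a : ℕ) + 1) k) J) z v = 0 := by
    rintro ⟨a, ha⟩
    cases a with
    -- `{H_1, J}` vanishes identically, so its differential imposes no condition
    | zero =>
      have : poissonBracket (hamiltonianH n i (0 + 1) k) J =ᶠ[𝓝 z] fun _ => 0 :=
        hreg.mono fun w hw => (D.identity hk hk' hw).2
      simp only
      rw [this.fderiv_eq]; simp
    | succ a => exact hF ⟨a, by omega⟩
  -- derivatives of the polynomial families along `v`
  have hWd := hasPolyDerivAt_momentumPoly z v
  have hUd := hasPolyDerivAt_charPoly z v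
  have hXW := (hasPolyDerivAt_const (X ^ D.f) z v).mul hWd
  have hXWdeg : ∀ w : PhaseSpace n, (X ^ D.f * momentumPoly w).natDegree ≤ D.f + n := fun w =>
    natDegree_mul_le.trans (add_le_add (natDegree_X_pow_le _)
      (natDegree_le_of_degree_lt (momentumPoly_degree_lt w)))
  have hdiv := differentiableAt_coeff_div (U := fun w : PhaseSpace n => charPoly w.1) hXWdeg
    (fun k => (hXW k).1) (fun w => charPoly_monic w.1) (fun w => charPoly_natDegree w.1)
    (fun k => (hUd k).1)
  obtain ⟨ζ, hζ⟩ := exists_hasPolyDerivAt (P := D.rem) (M := n)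
    (fun w => natDegree_le_of_degree_lt (D.rem_degree_lt w)) (fun k => (hdiv k).2) v
  obtain ⟨τ, hτ⟩ := exists_hasPolyDerivAt (P := fun w => X ^ D.f * momentumPoly w /ₘ charPoly w.1)
    (M := D.f + n) (fun w => by
      rw [natDegree_divByMonic _ (charPoly_monic w.1)]
      exact (Nat.sub_le _ _).trans (hXWdeg w)) (fun k => (hdiv k).1) v
  have hHd := hasPolyDerivAt_vecPoly
    (H := fun w (a : Fin n) => hamiltonianH n i ((a : ℕ) + 1) k w)
    (fun r => (analyticAt_hamiltonianH i _ hz).differentiableAt) v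
  have hFd := hasPolyDerivAt_vecPoly
    (H := fun w (a : Fin n) => poissonBracket (hamiltonianH n i ((a : ℕ) + 1) k) J w)
    (fun r => (analyticAt_poissonBracket (analyticAt_hamiltonianH i _ hz)
      (D.analyticAt z)).differentiableAt) v
  have hH0 : (fun r : Fin n => fderiv ℝ (fun w => hamiltonianH n i ((r : ℕ) + 1) k w) z v) = 0 :=
    funext fun r => hH r
  have hF0 : (fun r : Fin n =>
      fderiv ℝ (fun w => poissonBracket (hamiltonianH n i ((r : ℕ) + 1) k) J w) z v) = 0 :=
    funext fun r => hF' r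
  rw [hH0, vecPoly_zero] at hHd
  rw [hF0, vecPoly_zero] at hFd
  have hκd := hasPolyDerivAt_C (D.differentiableAt_κ z) v
  rw [D.fderiv_κ z hv, C_0] at hκd
  have hl := hκd.mul (((hasPolyDerivAt_const (C (1 / 2)) z v).mul (hζ.mul hζ)).add
    (hasPolyDerivAt_const (potentialSource n e k) z v))
  have hr := ((hκd.mul (hasPolyDerivAt_const (X ^ e) z v)).mul hHd).sub (hUd.mul hFd)
  have key := (hl.congr (hreg.mono fun w hw => by
    have := (D.identity hk hk' hw).1
    rw [sq] at this
    exact this)).unique hr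
  have hc : (C (1 / 2) : ℝ[X]) + C (1 / 2) = 1 := by rw [← C_add]; norm_num
  have key2 : C (D.κ z.1) * (D.rem z * ζ) = -(vecPoly v.1 *
      vecPoly fun a : Fin n => poissonBracket (hamiltonianH n i ((a : ℕ) + 1) k) J z) := by
    linear_combination key - C (D.κ z.1) * D.rem z * ζ * hc
  have hS0 : D.rem z ≠ 0 := fun h => h0 (by rw [h, coeff_zero])
  have hu : vecPoly v.1 = 0 := by
    have h1 : D.rem z ∣ vecPoly v.1 :=
      hcop.dvd_of_dvd_mul_right ⟨-(C (D.κ z.1) * ζ), by linear_combination key2⟩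
    obtain ⟨g, hg⟩ := h1
    by_contra hne
    have hg0 : g ≠ 0 := fun h => hne (by rw [hg, h, mul_zero])
    have h2 : (vecPoly v.1).natDegree ≤ n - 1 := natDegree_le_pred hn (vecPoly_degree_lt _)
    rw [hg, natDegree_mul hS0 hg0, hdeg] at h2
    have h3 : g = C (g.coeff 0) := eq_C_of_natDegree_eq_zero (by omega)
    have h4 : (vecPoly v.1).coeff 0 = 0 := by
      have := vecPoly_coeff v.1 ⟨n - 1, by omega⟩
      rw [← qc_succ v.1] at this
      simp only [Nat.sub_self, Nat.sub_add_cancel hn] at this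
      rw [this, hv]
    rw [hg, mul_coeff_zero, mul_eq_zero] at h4
    rcases h4 with h4 | h4
    · exact h0 h4
    · exact hg0 (by rw [h3, h4, C_0])
  have hζ0 : ζ = 0 := by
    rw [hu, zero_mul, neg_zero, mul_eq_zero, mul_eq_zero] at key2
    rcases key2 with h | h | h
    · exact absurd (C_eq_zero.1 h) (D.κ_ne_zero hq)
    · exact absurd h hS0
    · exact h
  have hW0 : momentumDeriv z v = 0 := by
    have h1 := hXW.unique (((hUd.mul hτ).add hζ).congr (Eventually.of_forall fun w => by
      simp only
      rw [add_comm]; exact modByMonic_add_div _ _))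
    rw [hu, hζ0] at h1
    refine eq_zero_of_charPoly_dvd (momentumDeriv_degree_lt z v)
      (((isCoprime_X_charPoly hq).pow_left (m := D.f)).symm.dvd_of_dvd_mul_left ⟨τ, ?_⟩)
    linear_combination h1
  have hv1 : v.1 = 0 := vecPoly_injective (hu.trans vecPoly_zero.symm)
  have hv2 : v.2 = 0 := by
    apply sum_horner_eq_zero z.1 n
    have h2 : ∀ j, hornerDeriv (0 : Fin n → ℝ) j = 0 := fun j => by
      rw [hornerDeriv_eq_sum]; simp [qc]
    simp only [momentumDeriv, hv1, h2, mul_zero, add_zero] at hW0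
    exact neg_eq_zero.1 hW0
  exact Prod.ext hv1 hv2

end MomentumSymmetry

/-! ### Functional independence and quadratic dependence: general criteria -/

/-- If `l` becomes injective after adding one functional, then by dimension it has a dual family. -/
theorem exists_dual_family {E ι : Type*} [NormedAddCommGroup E] [NormedSpace ℝ E]
    [FiniteDimensional ℝ E] [Fintype ι] [DecidableEq ι] (l : ι → E →L[ℝ] ℝ) (φ : E →ₗ[ℝ] ℝ)
    (hcard : Module.finrank ℝ E = Fintype.card ι + 1)
    (h : ∀ v, (∀ a, l a v = 0) → φ v = 0 → v = 0) :
    ∃ V : ι → E, ∀ a b, l a (V b) = if a = b then 1 else 0 := by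
  let Λ : E →ₗ[ℝ] (ι → ℝ) × ℝ := (LinearMap.pi fun a => (l a : E →ₗ[ℝ] ℝ)).prod φ
  have hinj : Function.Injective Λ := by
    rw [injective_iff_map_eq_zero]
    intro v hv
    have h1 := congrArg Prod.fst hv
    exact h v (fun a => congrFun h1 a) (congrArg Prod.snd hv)
  have hsurj : Function.Surjective Λ :=
    (LinearMap.injective_iff_surjective_of_finrank_eq_finrank (by simp [hcard])).1 hinj
  choose V hV using fun b : ι => hsurj (fun a => if a = b then 1 else 0, 0)
  exact ⟨V, fun a b => congrFun (congrArg Prod.fst (hV b)) a⟩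

theorem linearIndependent_of_det_ne_zero {E ι : Type*} [NormedAddCommGroup E] [NormedSpace ℝ E]
    [Fintype ι] [DecidableEq ι] {l : ι → E →L[ℝ] ℝ} {V : ι → E}
    (h : (Matrix.of fun a b => l a (V b)).det ≠ 0) : LinearIndependent ℝ l := by
  rw [Fintype.linearIndependent_iff]
  intro c hc
  have : Matrix.vecMul c (Matrix.of fun a b => l a (V b)) = 0 := by
    ext b
    have := congrArg (fun α : E →L[ℝ] ℝ => α (V b)) hc
    simpa [Matrix.vecMul, dotProduct, _root_.sum_apply] using this
  exact fun a => congrFun (Matrix.eq_zero_of_vecMul_eq_zero h this) a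

/-- For functions analytic on `qⁿ ≠ 0`, independence at one point of each of the two half
spaces `±qⁿ > 0` gives functional independence: the minor of the Jacobian attached to the family
`V` is analytic on a convex set. -/
theorem functionallyIndependent_of_dual_points (hn : 0 < n) {ι : Type} [Fintype ι] [DecidableEq ι]
    {k : ℤ} {F : ι → PhaseSpace n → ℝ} (hF : ∀ a z, qc z.1 n ≠ 0 → AnalyticAt ℝ (F a) z)
    (h : ∀ ε : ℝ, ε = 1 ∨ ε = -1 → ∃ (z : PhaseSpace n) (V : ι → PhaseSpace n),
      0 < ε * qc z.1 n ∧ ∀ a b, fderiv ℝ (F a) z (V b) = if a = b then 1 else 0) :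
    FunctionallyIndependent (cotangent (chart n k)) F := by
  refine ⟨{z | qc z.1 n ≠ 0} ∩ (fun z a => fderiv ℝ (F a) z) ⁻¹'
    {l | LinearIndependent ℝ l}, ?_, ?_, ?_, fun z hz => hz.2⟩
  · refine ContinuousOn.isOpen_inter_preimage ?_ isOpen_regular isOpen_setOfPred_linearIndependent
    exact continuousOn_pi.2 fun a z hz => (hF a z hz).fderiv.continuousAt.continuousWithinAt
  · exact fun z hz => regular_subset_cotangent_chart n k hz.1
  · refine fun z _ => closure_minimal (fun z hz => ?_) isClosed_closure (dense_regular hn z)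
    obtain ⟨ε, hε, hεz⟩ : ∃ ε : ℝ, (ε = 1 ∨ ε = -1) ∧ 0 < ε * qc z.1 n := by
      rcases lt_or_gt_of_ne (show qc z.1 n ≠ 0 from hz) with h0 | h0
      · exact ⟨-1, Or.inr rfl, by linarith⟩
      · exact ⟨1, Or.inl rfl, by linarith⟩
    obtain ⟨z₀, V, hz₀, hV⟩ := h ε hε
    -- the component of `z` in the regular set is convex
    set S : Set (PhaseSpace n) := {w | 0 < ε * qc w.1 n} with hS
    have hreg : ∀ w ∈ S, qc w.1 n ≠ 0 := fun w hw h0 => by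
      rw [hS, Set.mem_ofPred_eq, h0, mul_zero] at hw; exact lt_irrefl 0 hw
    have hconv : Convex ℝ S := by
      have hl : n - 1 < n := by omega
      intro x hx y hy a b ha hb hab
      have hqc : ∀ w : PhaseSpace n, qc w.1 n = w.1 ⟨n - 1, hl⟩ := fun w => by
        rw [qc, if_neg hn.ne', dif_pos hl]
      simp only [hS, Set.mem_ofPred_eq, hqc] at hx hy ⊢
      have h1 : (a • x + b • y).1 ⟨n - 1, hl⟩ = a * x.1 ⟨n - 1, hl⟩ + b * y.1 ⟨n - 1, hl⟩ := rfl
      rw [h1]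
      have h2 : ε * (a * x.1 ⟨n - 1, hl⟩ + b * y.1 ⟨n - 1, hl⟩) =
        a * (ε * x.1 ⟨n - 1, hl⟩) + b * (ε * y.1 ⟨n - 1, hl⟩) := by ring
      rw [h2]
      rcases ha.eq_or_lt with rfl | ha
      · rw [zero_add] at hab; subst hab; simpa using hy
      · exact add_pos_of_pos_of_nonneg (mul_pos ha hx) (mul_nonneg hb hy.le)
    let g : PhaseSpace n → ℝ := fun w => (Matrix.of fun a b => fderiv ℝ (F a) w (V b)).det
    have hg : AnalyticOnNhd ℝ g S := by
      intro w hw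
      simp only [g, Matrix.det_apply', Matrix.of_apply]
      exact Finset.analyticAt_fun_sum _ fun σ _ => analyticAt_const.mul
        (Finset.analyticAt_fun_prod _ fun a _ =>
          ((ContinuousLinearMap.apply ℝ ℝ (V a)).analyticAt _).comp (hF (σ a) w (hreg w hw)).fderiv)
    by_contra hcl
    have hev : g =ᶠ[𝓝 z] 0 := by
      filter_upwards [isClosed_closure.isOpen_compl.eventually_mem hcl,
        isOpen_regular.eventually_mem hz] with w hw hw'
      by_contra hdet
      exact hw (subset_closure ⟨hw', linearIndependent_of_det_ne_zero hdet⟩)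
    have h0 := hg.eqOn_zero_of_preconnected_of_eventuallyEq_zero hconv.isPreconnected
      (show z ∈ S from hεz) hev (show z₀ ∈ S from hz₀)
    have h1 : g z₀ = 1 := by
      have : (Matrix.of fun a b => fderiv ℝ (F a) z₀ (V b)) = 1 := by
        ext a b; rw [Matrix.of_apply, hV, Matrix.one_apply]
      simp only [g, this, Matrix.det_one]
    rw [h1] at h0
    exact one_ne_zero h0

section Quadratic

theorem fderiv_comp_fst {g : (Fin n → ℝ) → ℝ} {z : PhaseSpace n} (hg : AnalyticAt ℝ g z.1)
    (v : PhaseSpace n) : fderiv ℝ (fun w : PhaseSpace n => g w.1) z v = fderiv ℝ g z.1 v.1 := by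
  have h : HasFDerivAt (fun w : PhaseSpace n => g w.1) _ z :=
    HasFDerivAt.comp z (g := g) hg.differentiableAt.hasFDerivAt
      (ContinuousLinearMap.fst ℝ (Fin n → ℝ) (Fin n → ℝ)).hasFDerivAt
  rw [h.fderiv]; rfl

theorem fderiv_quadratic {M : (Fin n → ℝ) → Matrix (Fin n) (Fin n) ℝ} {z : PhaseSpace n}
    (hM : ∀ l m, AnalyticAt ℝ (fun w => M w l m) z.1) (v : PhaseSpace n) :
    fderiv ℝ (fun w : PhaseSpace n => ∑ l : Fin n, ∑ m : Fin n, M w.1 l m * w.2 l * w.2 m) z v =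
      ∑ l : Fin n, ∑ m : Fin n, (fderiv ℝ (fun w => M w l m) z.1 v.1 * z.2 l * z.2 m +
        M z.1 l m * (v.2 l * z.2 m + z.2 l * v.2 m)) := by
  have h : HasFDerivAt (fun w : PhaseSpace n => ∑ l : Fin n, ∑ m : Fin n,
      M w.1 l m * w.2 l * w.2 m) _ z :=
    HasFDerivAt.fun_sum fun l _ => HasFDerivAt.fun_sum fun m _ =>
      (((analyticAt_comp_fst (hM l m)).differentiableAt.hasFDerivAt.mul
        (hasFDerivAt_momentum l z)).mul (hasFDerivAt_momentum m z))
  rw [h.fderiv, _root_.sum_apply]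
  refine Finset.sum_congr rfl fun l _ => ?_
  rw [_root_.sum_apply]
  refine Finset.sum_congr rfl fun m _ => ?_
  simp only [_root_.add_apply, _root_.smul_apply, smul_eq_mul, ContinuousLinearMap.comp_apply,
    ContinuousLinearMap.coe_snd', ContinuousLinearMap.proj_apply, Pi.mul_apply, fderiv_comp_fst (hM l m)]
  ring

theorem sum_mulVec_left (M B : Matrix (Fin n) (Fin n) ℝ) (p : Fin n → ℝ) :
    ∑ l : Fin n, ∑ m : Fin n, M l m * (B.mulVec p l * p m + p l * B.mulVec p m) =
      ∑ l : Fin n, ∑ m : Fin n, (B.transpose * M + M * B) l m * p l * p m := by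
  have e1 : ∑ l : Fin n, ∑ m : Fin n, M l m * (B.mulVec p l * p m) =
      ∑ l : Fin n, ∑ m : Fin n, (B.transpose * M) l m * p l * p m := by
    simp only [Matrix.mulVec, dotProduct, Matrix.mul_apply, Matrix.transpose_apply,
      Finset.sum_mul, Finset.mul_sum]
    rw [Finset.sum_congr rfl fun l _ => Finset.sum_comm, Finset.sum_comm]
    refine Finset.sum_congr rfl fun l _ => ?_
    rw [Finset.sum_comm]
    exact Finset.sum_congr rfl fun m _ => Finset.sum_congr rfl fun c _ => by ring
  have e2 : ∑ l : Fin n, ∑ m : Fin n, M l m * (p l * B.mulVec p m) =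
      ∑ l : Fin n, ∑ m : Fin n, (M * B) l m * p l * p m := by
    simp only [Matrix.mulVec, dotProduct, Matrix.mul_apply, Finset.sum_mul, Finset.mul_sum]
    refine Finset.sum_congr rfl fun l _ => ?_
    rw [Finset.sum_comm]
    exact Finset.sum_congr rfl fun m _ => Finset.sum_congr rfl fun c _ => by ring
  simp only [mul_add, Finset.sum_add_distrib, Matrix.add_apply, add_mul, e1, e2]

theorem polarization (B : Matrix (Fin n) (Fin n) ℝ) (a b : Fin n) :
    (∑ l : Fin n, ∑ m : Fin n, B l m * (Pi.single a 1 + Pi.single b 1 : Fin n → ℝ) l *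
        (Pi.single a 1 + Pi.single b 1 : Fin n → ℝ) m) -
      (∑ l : Fin n, ∑ m : Fin n, B l m * (Pi.single a 1 : Fin n → ℝ) l *
        (Pi.single a 1 : Fin n → ℝ) m) -
      (∑ l : Fin n, ∑ m : Fin n, B l m * (Pi.single b 1 : Fin n → ℝ) l *
        (Pi.single b 1 : Fin n → ℝ) m) = B a b + B b a := by
  have h : ∀ c d : Fin n, ∑ l : Fin n, ∑ m : Fin n, B l m * (Pi.single c 1 : Fin n → ℝ) l *
      (Pi.single d 1 : Fin n → ℝ) m = B c d := by
    intro c d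
    rw [Finset.sum_eq_single c, Finset.sum_eq_single d]
    · simp
    · intro m _ hm; simp [Pi.single_eq_of_ne hm]
    · simp
    · intro l _ hl; simp [Pi.single_eq_of_ne hl]
    · simp
  simp only [Pi.add_apply, mul_add, add_mul, Finset.sum_add_distrib, h]
  ring

/-- No regularity of `B` and `c` is needed: polarization recovers the symmetric part of `B` and
`c` from values of `f`. -/
theorem isQuadraticInMomenta_of_exists {k : ℤ} {f : PhaseSpace n → ℝ}
    (hf : ∀ z ∈ cotangent (chart n k), AnalyticAt ℝ f z)
    {B : (Fin n → ℝ) → Matrix (Fin n) (Fin n) ℝ} {c : (Fin n → ℝ) → ℝ}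
    (h : ∀ z ∈ cotangent (chart n k),
      f z = ∑ l : Fin n, ∑ m : Fin n, B z.1 l m * z.2 l * z.2 m + c z.1)
    (hB : ∃ z : PhaseSpace n, z ∈ cotangent (chart n k) ∧
      ∑ l : Fin n, ∑ m : Fin n, B z.1 l m * z.2 l * z.2 m ≠ 0) :
    IsQuadraticInMomenta (chart n k) f := by
  have hsym : ∀ q p : Fin n → ℝ, ∑ l : Fin n, ∑ m : Fin n, (1 / 2 * (B q l m + B q m l)) * p l * p m =
      ∑ l : Fin n, ∑ m : Fin n, B q l m * p l * p m := by
    intro q p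
    have h1 : ∑ l : Fin n, ∑ m : Fin n, B q m l * p l * p m =
        ∑ l : Fin n, ∑ m : Fin n, B q l m * p l * p m := by
      rw [Finset.sum_comm]
      exact Finset.sum_congr rfl fun l _ => Finset.sum_congr rfl fun m _ => by ring
    have h2 : ∀ l m, (1 / 2 * (B q l m + B q m l)) * p l * p m =
        1 / 2 * (B q l m * p l * p m) + 1 / 2 * (B q m l * p l * p m) := fun l m => by ring
    simp only [h2, Finset.sum_add_distrib, ← Finset.mul_sum, h1]
    ring
  have hsec : ∀ q ∈ chart n k, ∀ p : Fin n → ℝ, AnalyticAt ℝ (fun w => f (w, p)) q := fun q hq p =>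
    AnalyticAt.comp (f := fun w => (w, p)) (hf (q, p) hq) (analyticAt_id.prod analyticAt_const)
  have hpos : ∀ q ∈ chart n k, ∀ᶠ w in 𝓝 q, w ∈ chart n k := by
    intro q hq
    have := (isOpen_cotangent_chart n k).eventually_mem (show ((q, 0) : PhaseSpace n) ∈ _ from hq)
    exact (Continuous.prodMk_left (0 : Fin n → ℝ)).continuousAt.eventually this
  refine ⟨fun q => Matrix.of fun l m => 1 / 2 * (B q l m + B q m l), c, fun l m q hq => ?_,
    fun q hq => ?_, fun q _ => ?_, ?_, fun z hz => ?_⟩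
  · have h1 : AnalyticAt ℝ (fun w => 1 / 2 * (f (w, Pi.single l 1 + Pi.single m 1) -
        f (w, Pi.single l 1) - f (w, Pi.single m 1) + f (w, 0))) q :=
      analyticAt_const.mul ((((hsec q hq _).sub (hsec q hq _)).sub (hsec q hq _)).add
        (hsec q hq _))
    refine h1.congr ((hpos q hq).mono fun w hw => ?_)
    simp only [Matrix.of_apply]
    rw [← polarization (B w) l m, h (w, _) hw, h (w, _) hw, h (w, _) hw, h (w, 0) hw]
    simp only [Pi.zero_apply, mul_zero, Finset.sum_const_zero]
    ring
  · refine (hsec q hq 0).congr ((hpos q hq).mono fun w hw => ?_)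
    simp only [h (w, 0) hw]
    simp
  · ext l m; simp [Matrix.transpose_apply, add_comm]
  · obtain ⟨z, hz, hne⟩ := hB
    refine ⟨z.1, hz, fun h0 => hne ?_⟩
    rw [← hsym]
    have : ∀ l m, 1 / 2 * (B z.1 l m + B z.1 m l) = 0 := fun l m => congrFun (congrFun h0 l) m
    simp only [this, zero_mul, Finset.sum_const_zero]
  · simp only [Matrix.of_apply]
    rw [hsym, h z hz]

end Quadratic

/-! ### Independence and quadratic form of the integrals -/

namespace MomentumSymmetry

variable {i e : ℕ} {J : PhaseSpace n → ℝ} (D : MomentumSymmetry n i e J)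
include D

/-- A point with `qⁿ = (-1)ⁿ r` at which the differentials of the `2n - 1` integrals are linearly
independent, witnessed by a dual family of vectors. -/
theorem exists_dual_point (hn : 2 ≤ n) {k : ℤ} (hk : -(e : ℤ) ≤ k) (hk' : k ≤ (n : ℤ) - 1 - e)
    {r : ℝ} (hr0 : r ≠ 0) (hr1 : r ≠ 1) :
    ∃ (z : PhaseSpace n) (V : Fin n ⊕ Fin (n - 1) → PhaseSpace n), qc z.1 n = (-1) ^ n * r ∧
      ∀ a b, fderiv ℝ ((Sum.elim (fun a : Fin n => hamiltonianH n i ((a : ℕ) + 1) k)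
        (fun b : Fin (n - 1) => poissonBracket (hamiltonianH n i ((b : ℕ) + 2) k) J) :
          Fin n ⊕ Fin (n - 1) → PhaseSpace n → ℝ) a) z (V b) = if a = b then 1 else 0 := by
  obtain ⟨q, hq⟩ := exists_charPoly_eq_test (n := n) (by omega) r
  have hqn : qc q n = (-1) ^ n * r := by
    obtain ⟨m, rfl⟩ : ∃ m, n = m + 1 := ⟨n - 1, by omega⟩
    rw [← charPoly_eval_zero, hq]
    simp only [eval_mul, eval_pow, eval_sub, eval_X, eval_C, Nat.add_sub_cancel]
    ring
  have hqn0 : qc q n ≠ 0 := by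
    rw [hqn]; exact mul_ne_zero (pow_ne_zero _ (by norm_num)) hr0
  have hSm : ((X - C 1 : ℝ[X]) ^ (n - 1)).natDegree = n - 1 := by
    rw [natDegree_pow, natDegree_X_sub_C, mul_one]
  have hpt : ∀ s : ℕ, ∃ p : Fin n → ℝ, D.rem (q, p) = C (s : ℝ) * (X - C 1) ^ (n - 1) := by
    intro s
    have hSd : (C (s : ℝ) * (X - C 1) ^ (n - 1) : ℝ[X]).degree < n := by
      refine lt_of_le_of_lt degree_le_natDegree ?_
      have := (natDegree_C_mul_le (s : ℝ) ((X - C 1) ^ (n - 1))).trans hSm.le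
      exact_mod_cast lt_of_le_of_lt this (by omega)
    obtain ⟨W, hW, hrem⟩ := exists_mul_modByMonic_eq hqn0 D.f hSd
    obtain ⟨p, hp⟩ := exists_momentumPoly_eq q hW
    exact ⟨p, by rw [rem, hp]; exact hrem⟩
  choose p hp using hpt
  have hne := eval_one_ne_of_test hn hr1 hq (D.κ_ne_zero hqn0) (e := e)
    (Ψ := potentialSource n e k)
    (H := fun s => vecPoly fun a : Fin n => hamiltonianH n i ((a : ℕ) + 1) k (q, p s))
    (F := fun s => vecPoly fun a : Fin n =>
      poissonBracket (hamiltonianH n i ((a : ℕ) + 1) k) J (q, p s))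
    (fun s => vecPoly_degree_lt _) (fun s => by
      have := (D.identity hk hk' (z := (q, p s)) hqn0).1
      rwa [hp] at this)
  obtain ⟨s, hs0, hs⟩ : ∃ s : ℕ, (s : ℝ) ≠ 0 ∧ (vecPoly fun a : Fin n =>
      poissonBracket (hamiltonianH n i ((a : ℕ) + 1) k) J (q, p s)).eval 1 ≠ 0 := by
    by_cases h1 : (vecPoly fun a : Fin n =>
      poissonBracket (hamiltonianH n i ((a : ℕ) + 1) k) J (q, p 1)).eval 1 = 0
    · exact ⟨2, by norm_num, fun h2 => hne (h1.trans h2.symm)⟩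
    · exact ⟨1, by norm_num, h1⟩
  have hcop := isCoprime_test hs0 (hp s) hs
  have hdeg : (D.rem (q, p s)).natDegree = n - 1 := by
    rw [hp, natDegree_C_mul hs0, hSm]
  have hcoeff : (D.rem (q, p s)).coeff 0 ≠ 0 := by
    rw [hp, coeff_C_mul, coeff_zero_eq_eval_zero]
    simp [hs0]
  have hl : n - 1 < n := by omega
  let φ : PhaseSpace n →ₗ[ℝ] ℝ :=
    (LinearMap.proj ⟨n - 1, hl⟩).comp (LinearMap.fst ℝ (Fin n → ℝ) (Fin n → ℝ))
  obtain ⟨V, hV⟩ := exists_dual_family (fun a : Fin n ⊕ Fin (n - 1) =>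
    fderiv ℝ ((Sum.elim (fun a : Fin n => hamiltonianH n i ((a : ℕ) + 1) k)
        (fun b : Fin (n - 1) => poissonBracket (hamiltonianH n i ((b : ℕ) + 2) k) J) :
          Fin n ⊕ Fin (n - 1) → PhaseSpace n → ℝ) a) (q, p s)) φ (by simp; omega)
    (fun v hv hφ => D.eq_zero_of_forall_fderiv_eq_zero hk hk' (z := (q, p s)) hqn0 hcop hdeg hcoeff
      (by rw [qc, if_neg (by omega), dif_pos hl]; exact hφ) (fun a => hv (Sum.inl a))
      (fun b => hv (Sum.inr b)))
  exact ⟨(q, p s), V, hqn, hV⟩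

theorem functionallyIndependent (hn : 2 ≤ n) {k : ℤ} (hk : -(e : ℤ) ≤ k)
    (hk' : k ≤ (n : ℤ) - 1 - e) :
    FunctionallyIndependent (cotangent (chart n k))
      (Sum.elim (fun a : Fin n => hamiltonianH n i ((a : ℕ) + 1) k)
        (fun b : Fin (n - 1) => poissonBracket (hamiltonianH n i ((b : ℕ) + 2) k) J)) := by
  refine functionallyIndependent_of_dual_points (by omega) ?_ ?_
  · rintro (a | b) z hz
    · exact analyticAt_hamiltonianH i _ (regular_subset_cotangent_chart n k hz)
    · exact analyticAt_poissonBracket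
        (analyticAt_hamiltonianH i _ (regular_subset_cotangent_chart n k hz)) (D.analyticAt z)
  · intro ε hε
    have hε0 : ε * ε = 1 := by rcases hε with rfl | rfl <;> norm_num
    have hs : ((-1 : ℝ) ^ n) * (-1) ^ n = 1 := by rw [← mul_pow]; norm_num
    have hr : ∀ x : ℝ, x * x = 4 → x ≠ 0 ∧ x ≠ 1 := fun x hx =>
      ⟨by rintro rfl; norm_num at hx, by rintro rfl; norm_num at hx⟩
    -- `r = ±2` is chosen so that `qⁿ = (-1)ⁿ r = 2 ε`
    obtain ⟨h0, h1⟩ := hr (2 * ((-1) ^ n * ε)) (by linear_combination 4 * ε * ε * hs + 4 * hε0)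
    obtain ⟨z, V, hz, hV⟩ := D.exists_dual_point hn hk hk' h0 h1
    refine ⟨z, V, ?_, hV⟩
    rw [hz, show ε * ((-1) ^ n * (2 * ((-1) ^ n * ε))) = 2 by
      linear_combination 2 * ε * ε * hs + 2 * hε0]
    norm_num

/-- The quadratic form `B` can be chosen independent of `k`, and the remaining function of `q`
is the derivative of the potential, zero for `k = 0`. -/
theorem poissonBracket_hamiltonianH_eq (r : ℕ) :
    ∃ B : (Fin n → ℝ) → Matrix (Fin n) (Fin n) ℝ, ∀ k : ℤ, ∃ c : (Fin n → ℝ) → ℝ,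
      (k = 0 → c = 0) ∧ ∀ z ∈ cotangent (chart n k), poissonBracket (hamiltonianH n i r k) J z =
        ∑ l : Fin n, ∑ m : Fin n, B z.1 l m * z.2 l * z.2 m + c z.1 := by
  have hl : n - 1 - e < n := by have := D.he; omega
  let a : (Fin n → ℝ) → Fin n → ℝ := fun q => D.κ q • Pi.single ⟨n - 1 - e, hl⟩ 1
  let M : (Fin n → ℝ) → Matrix (Fin n) (Fin n) ℝ := fun q =>
    killingK n r q * tensorL n q ^ i * metricG n q
  refine ⟨fun q => Matrix.of fun l m => 1 / 2 * (fderiv ℝ (fun w => M w l m) q (a q) +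
    ((D.β q).transpose * M q + M q * D.β q) l m), fun k =>
    ⟨fun q => fderiv ℝ (fun w => potentialV n w k r) q (a q), ?_, fun z hz => ?_⟩⟩
  · rintro rfl
    have : ∀ w : Fin n → ℝ, potentialV n w 0 r = 0 := fun _ => rfl
    funext q; simp [this]
  · have hM := analyticAt_geodesic_matrix i r z.1
    have hV := analyticAt_potentialV r hz
    have hE : HasFDerivAt (hamiltonianH n i r k) _ z :=
      ((analyticAt_quadratic hM).differentiableAt.hasFDerivAt.const_mul (1 / 2)).add
        (analyticAt_comp_fst hV).differentiableAt.hasFDerivAt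
    rw [poissonBracket_eq_left, hE.fderiv, D.flow_eq]
    simp only [_root_.add_apply, _root_.smul_apply, smul_eq_mul]
    rw [fderiv_quadratic hM, fderiv_comp_fst hV]
    congr 1
    simp only [Finset.sum_add_distrib, sum_mulVec_left, Matrix.of_apply]
    rw [← Finset.sum_add_distrib, Finset.mul_sum]
    refine Finset.sum_congr rfl fun l _ => ?_
    rw [← Finset.sum_add_distrib, Finset.mul_sum]
    exact Finset.sum_congr rfl fun m _ => by simp only [M, a]; ring

theorem isQuadraticInMomenta (hn : 2 ≤ n) {k : ℤ} {s : ℕ} (hs : s ∈ Finset.Icc 2 n) :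
    IsQuadraticInMomenta (chart n k) (poissonBracket (hamiltonianH n i s k) J) := by
  have he := D.he
  obtain ⟨B, hB⟩ := D.poissonBracket_hamiltonianH_eq s
  obtain ⟨c, -, hc⟩ := hB k
  obtain ⟨c0, hc0, hB0⟩ := hB 0
  refine isQuadraticInMomenta_of_exists (fun z hz =>
    analyticAt_poissonBracket (analyticAt_hamiltonianH i s hz) (D.analyticAt z)) hc ?_
  by_contra! hcon
  rw [Finset.mem_Icc] at hs
  -- if the quadratic part vanished, `F_s` would vanish for `k = 0`, contradicting independence
  obtain ⟨z, V, hz, hV⟩ := D.exists_dual_point hn (k := 0) (by omega) (by omega)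
    (r := 2) (by norm_num) (by norm_num)
  have hzr : qc z.1 n ≠ 0 := by
    rw [hz]; exact mul_ne_zero (pow_ne_zero _ (by norm_num)) (by norm_num)
  have hzero : poissonBracket (hamiltonianH n i s 0) J =ᶠ[𝓝 z] fun _ => 0 :=
    (isOpen_regular.eventually_mem hzr).mono fun w hw => by
      rw [hB0 w (regular_subset_cotangent_chart n 0 hw), hcon w
        (regular_subset_cotangent_chart n k hw), hc0 rfl, Pi.zero_apply, add_zero]
  have h1 := hV (Sum.inr ⟨s - 2, by omega⟩) (Sum.inr ⟨s - 2, by omega⟩)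
  simp only [Sum.elim_inr, Nat.sub_add_cancel hs.1, if_true] at h1
  rw [hzero.fderiv_eq] at h1
  simp at h1

end MomentumSymmetry

theorem exists_momentumSymmetry {i : ℕ} {k : ℤ} {J : PhaseSpace n → ℝ} (hn : 2 ≤ n)
    (hcase : (i ≤ n - 1 ∧ -(i : ℤ) ≤ k ∧ k ≤ (n : ℤ) - 1 - i ∧ J = fun z => pc z.2 (n - i)) ∨
      ((i = n ∨ i = n + 1) ∧ 2 - (i : ℤ) ≤ k ∧ k ≤ (n : ℤ) + 1 - i ∧
        J = fun z => qc z.1 n * pc z.2 (n + 2 - i))) :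
    ∃ e : ℕ, -(e : ℤ) ≤ k ∧ k ≤ (n : ℤ) - 1 - e ∧ Nonempty (MomentumSymmetry n i e J) := by
  rcases hcase with ⟨hi, hk, hk', rfl⟩ | ⟨hi, hk, hk', rfl⟩
  · exact ⟨i, hk, hk', nonempty_momentumSymmetry_translation hn hi⟩
  · exact ⟨i - 2, by omega, by omega, nonempty_momentumSymmetry_scaling hn hi⟩

end Benenti

end

theorem theorem1 (n : ℕ) (hn : 2 ≤ n) (i : ℕ) (k : ℤ) (J : Benenti.PhaseSpace n → ℝ)
    (hcase :
      (i ≤ n - 1 ∧ -(i : ℤ) ≤ k ∧ k ≤ (n : ℤ) - 1 - i ∧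
        J = fun z => Benenti.pc z.2 (n - i)) ∨
      ((i = n ∨ i = n + 1) ∧ 2 - (i : ℤ) ≤ k ∧ k ≤ (n : ℤ) + 1 - i ∧
        J = fun z => Benenti.qc z.1 n * Benenti.pc z.2 (n + 2 - i))) :
    Benenti.IsMaximallySuperintegrable (Benenti.cotangent (Benenti.chart n k))
      (Benenti.hamiltonianH n i 1 k) ∧
    (∀ r ∈ Finset.Icc 1 n,
      Benenti.IsIntegralOfMotion (Benenti.cotangent (Benenti.chart n k))
        (Benenti.hamiltonianH n i 1 k) (Benenti.hamiltonianH n i r k)) ∧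
    (∀ r ∈ Finset.Icc 1 n, ∀ s ∈ Finset.Icc 1 n,
      ∀ z ∈ Benenti.cotangent (Benenti.chart n k),
        Benenti.poissonBracket (Benenti.hamiltonianH n i r k)
          (Benenti.hamiltonianH n i s k) z = 0) ∧
    (∀ s ∈ Finset.Icc 2 n,
      Benenti.IsIntegralOfMotion (Benenti.cotangent (Benenti.chart n k))
        (Benenti.hamiltonianH n i 1 k)
        (Benenti.poissonBracket (Benenti.hamiltonianH n i s k) J) ∧
      Benenti.IsQuadraticInMomenta (Benenti.chart n k)
        (Benenti.poissonBracket (Benenti.hamiltonianH n i s k) J)) ∧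
    Benenti.FunctionallyIndependent (Benenti.cotangent (Benenti.chart n k))
      (Sum.elim
        (fun a : Fin n => Benenti.hamiltonianH n i ((a : ℕ) + 1) k)
        (fun b : Fin (n - 1) =>
          Benenti.poissonBracket (Benenti.hamiltonianH n i ((b : ℕ) + 2) k) J)) := by
  obtain ⟨e, hk, hk', ⟨D⟩⟩ := Benenti.exists_momentumSymmetry hn hcase
  have hinv : ∀ r ∈ Finset.Icc 1 n, ∀ s ∈ Finset.Icc 1 n,
      ∀ z ∈ Benenti.cotangent (Benenti.chart n k),
        Benenti.poissonBracket (Benenti.hamiltonianH n i r k)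
          (Benenti.hamiltonianH n i s k) z = 0 := fun r hr s hs z hz =>
    Benenti.poissonBracket_hamiltonianH_eq_zero hk hr hs hz
  have h1 : 1 ∈ Finset.Icc 1 n := Finset.mem_Icc.2 ⟨le_rfl, by omega⟩
  have hmem : ∀ a : Fin n, (a : ℕ) + 1 ∈ Finset.Icc 1 n := fun a =>
    Finset.mem_Icc.2 ⟨by omega, by omega⟩
  have hint : ∀ r ∈ Finset.Icc 1 n,
      Benenti.IsIntegralOfMotion (Benenti.cotangent (Benenti.chart n k))
        (Benenti.hamiltonianH n i 1 k) (Benenti.hamiltonianH n i r k) := fun r hr =>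
    ⟨fun z hz => Benenti.analyticAt_hamiltonianH i r hz, hinv 1 h1 r hr⟩
  have hF := D.functionallyIndependent hn hk hk'
  refine ⟨⟨_, _, ⟨⟨0, by omega⟩, rfl⟩, fun a => hint _ (hmem a),
    fun a b => hinv _ (hmem a) _ (hmem b), fun b => D.isIntegralOfMotion_poissonBracket hk hk' ?_, hF⟩,
    hint, hinv, fun s hs => ⟨D.isIntegralOfMotion_poissonBracket hk hk' ?_,
      D.isQuadraticInMomenta hn hs⟩, hF⟩
  · exact Finset.mem_Icc.2 ⟨by omega, by omega⟩
  · rw [Finset.mem_Icc] at hs ⊢; omega
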